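/- Setting (planar absolute geometry). Consider a set of points in which certain subsets are called lines, with a strict betweenness relation on points and a congruence relation $\cong$ on segments, such that the following hold. (Incidence) Two distinct points lie on exactly one line, every line has at least two points, and not all points are collinear. (Order) If $B$ is between $A$ and $C$ then $A,B,C$ are distinct and collinear, $B$ is between $C$ and $A$, and $C$ is not between $A$ and $B$; every segment $AB$ can be extended beyond $B$; every line $l$ partitions the points not on $l$ into two non-empty convex sides, and meets every segment whose ends lie on different sides. (Segments) Congruence of (undirected) segments is an equivalence relation; on every ray based at $O$ there is exactly one point $X\neq O$ with $OX$ congruent to a given segment; sums of congruent adjacent collinear segments are congruent; every segment has a midpoint. (Triangle transport) If $A,B,C$ are non-collinear and $A'B'\cong AB$ with $A',B'$ on a line $l$, then on either side of $l$ there is a point $C'$ with $A'C'\cong AC$ and $B'C'\cong BC$. (Right angles) If $A,B,C$ are non-collinear, $AB\cong AC$ and $M$ is the midpoint of $BC$, the angles $\angle AMB$ and $\angle AMC$ (as unions of two rays) are called paired right angles; a right angle is one that belongs to such a pair on at least one of its sides. If $\angle BAC$ and $\angle EDF$ are right angles with $AB\cong DE$ and $AC\cong DF$, then $BC\cong EF$.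 At most one angle of a triangle is a right angle. Coordinates. An ordered line is a line with one of the two mutually opposite total orders of its points that determine betweenness on it. Fix a reference ordered line $r$, and let $T$ be the ordered group of translations of $r$, that is, of the order-preserving permutations of the points of $r$ that take each segment to a congruent one, where $s<t$ means that $s(X)<t(X)$ for all $X$ on $r$; write $T$ additively. The magnitude of a segment $AB$ is the positive $t\in T$ such that the segment from $X$ to $t(X)$ is congruent to $AB$ for every $X$ on $r$. For an ordered line $l$ and a point $O$ on $l$, the points of $l$ are coordinatized by the order-preserving bijection from $T$ to the points of $l$ that takes $0$ to $O$ and is such that the magnitude of each segment of $l$ is the difference of the coordinates of its ends. A system of axes is an ordered pair $(l,m)$ of perpendicular ordered lines (lines meeting at a point $O$ such that the angles that they form there are right angles); both are coordinatized with $0$ at $O$. A rigid motion is a permutation $\varphi$ of the points such that $\varphi(A)\varphi(B)\cong AB$ for all points $A\ne B$. Theorem. Let $(l,m)$ and $(l',m')$ be systems of axes, and let $f$ be a map from the points of $l\cup m$ to the points of $l'\cup m'$ that takes each point of $l$ to the point of $l'$ with the same coordinate and each point of $m$ to the point of $m'$ with the same coordinate. Then $f$ extends to a unique rigid motion of the plane.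 -/

import Mathlib

/-- The primitive notions of a plane geometry: lines (as sets of points), strict betweenness
(`Btw A B C`: `B` is a non-extreme point of the segment `AC`) and congruence of segments
(`Cong A B C D`: `AB ≅ CD`). -/
class PlaneData (P : Type*) where
  lines : Set (Set P)
  Btw : P → P → P → Prop
  Cong : P → P → P → P → Prop

namespace PlaneData

variable {P : Type*} [PlaneData P]

/-- Some line contains the three points. -/
def Coll (A B C : P) : Prop := ∃ l ∈ lines (P := P), A ∈ l ∧ B ∈ l ∧ C ∈ l

/-- A set of points is convex if it contains all points of a segment whenever it contains
the ends of that segment. -/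
def ConvexSet (H : Set P) : Prop := ∀ A ∈ H, ∀ B ∈ H, ∀ X, Btw A X B → X ∈ H

/-- `A` and `B` lie off `l`, on the same side of `l`. -/
def SameSide (l : Set P) (A B : P) : Prop := A ∉ l ∧ B ∉ l ∧ ∀ X ∈ l, ¬ Btw A X B

/-- For `A ≠ O`: the points other than `O` of the ray based at `O` through `A`. -/
def openRay (O A : P) : Set P := {X | X ≠ O ∧ (X = A ∨ Btw O X A ∨ Btw O A X)}

/-- `M` is the midpoint of the segment `BC`. -/
def IsMidpoint (M B C : P) : Prop := Btw B M C ∧ Cong M B M C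

/-- `A` is the apex of an isosceles triangle whose base `BC` has midpoint `M`. The angles `AMB` and
`AMC` are then paired right angles at `M`, on the side of the line `BC` that contains `A`. -/
def PairedRight (A M B C : P) : Prop :=
  ¬ Coll A B C ∧ IsMidpoint M B C ∧ Cong A B A C

/-- The angle with vertex `M` formed by the rays `MA` and `MB` is one of a pair of right angles, the
other one having the ray `MA` in common with it. -/
def RightAlong (A M B : P) : Prop :=
  ∃ A₀ ∈ openRay M A, ∃ B₀ ∈ openRay M B, ∃ C₀, PairedRight A₀ M B₀ C₀

/-- The angle `AMB` (the union of the rays `MA` and `MB`) is a right angle: it is part of a pair of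
right angles on at least one of its sides. -/
def IsRightAngle (A M B : P) : Prop :=
  A ≠ M ∧ B ≠ M ∧ (RightAlong A M B ∨ RightAlong B M A)

/-- `l` and `m` are lines meeting at `O`, and the angles that they form at `O` are right angles. -/
def PerpAt (O : P) (l m : Set P) : Prop :=
  l ∈ lines (P := P) ∧ m ∈ lines (P := P) ∧ O ∈ l ∧ O ∈ m ∧
    ∀ A ∈ l, ∀ B ∈ m, A ≠ O → B ≠ O → IsRightAngle A O B

end PlaneData

open PlaneData in
/-- Planar absolute geometry: incidence, betweenness with plane separation, congruence of segments
(including midpoints), transport of triangles, and two axioms on right angles. -/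
class AbsolutePlane (P : Type*) extends PlaneData P where
  /-- Two points lie on exactly one line. -/
  line_through : ∀ A B : P, A ≠ B → ∃! l : Set P, l ∈ lines ∧ A ∈ l ∧ B ∈ l
  two_points : ∀ l ∈ lines, ∃ A ∈ l, ∃ B ∈ l, A ≠ B
  three_points : ∃ A B C : P, ¬ Coll A B C
  btw_distinct : ∀ A B C : P, Btw A B C → A ≠ B ∧ B ≠ C ∧ A ≠ C
  btw_coll : ∀ A B C : P, Btw A B C → Coll A B C
  btw_symm : ∀ A B C : P, Btw A B C → Btw C B A
  btw_not : ∀ A B C : P, Btw A B C → ¬ Btw A C B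
  /-- Segments can be extended. -/
  btw_extend : ∀ A B : P, A ≠ B → ∃ C, Btw A B C
  /-- Plane separation: a line partitions the points off it into two convex sides, and it meets
  every segment with ends on different sides. -/
  separation : ∀ l ∈ lines, ∃ H K : Set P, H.Nonempty ∧ K.Nonempty ∧ Disjoint H K ∧ H ∪ K = lᶜ ∧
    ConvexSet H ∧ ConvexSet K ∧ ∀ A ∈ H, ∀ B ∈ K, ∃ X ∈ l, Btw A X B
  /-- A pair `A, A` counts as a null segment; null segments are congruent to each other only. -/
  cong_null : ∀ A B : P, Cong A A B B
  cong_null_eq : ∀ A B C : P, Cong A B C C → A = B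
  /-- Segments are undirected. -/
  cong_swap : ∀ A B : P, Cong A B B A
  cong_symm : ∀ A B C D : P, Cong A B C D → Cong C D A B
  cong_trans : ∀ A B C D E F : P, Cong A B C D → Cong C D E F → Cong A B E F
  /-- A segment can be transported to any ray, in only one way: every circle centered at the base
  of a ray meets the ray in a unique point. -/
  cong_transport : ∀ A B C D : P, A ≠ B → C ≠ D → ∃! X, X ∈ openRay C D ∧ Cong C X A B
  /-- Equals added to equals are equal. -/
  cong_add : ∀ A B C A' B' C' : P, Btw A B C → Btw A' B' C' →
    Cong A B A' B' → Cong B C B' C' → Cong A C A' C'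
  midpoint : ∀ A B : P, A ≠ B → ∃ M, IsMidpoint M A B
  /-- A triangle can be copied to any location: `ABC` to either side (the side of `X`) of a line
  that contains a segment `A'B'` congruent to `AB`. -/
  triangle_transport : ∀ A B C A' B' : P, ∀ l ∈ lines, ¬ Coll A B C → A' ∈ l → B' ∈ l →
    Cong A' B' A B → ∀ X, X ∉ l → ∃ C', SameSide l X C' ∧ Cong A' C' A C ∧ Cong B' C' B C
  /-- Right angles are alike everywhere. -/
  right_angles : ∀ B A C E D F : P, IsRightAngle B A C → IsRightAngle E D F →
    Cong A B D E → Cong A C D F → Cong B C E F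
  /-- At most one angle of a triangle is a right angle. -/
  one_right_angle : ∀ A B C : P, ¬ Coll A B C → ¬ (IsRightAngle B A C ∧ IsRightAngle A B C)

namespace AbsolutePlane

open PlaneData

/-- An ordered line: a line with one of the two (mutually opposite) total orders of its points that
determine its segments. -/
structure OrderedLine (P : Type*) [AbsolutePlane P] where
  carrier : Set P
  isLine : carrier ∈ lines
  lt : carrier → carrier → Prop
  irrefl : ∀ A, ¬ lt A A
  trans : ∀ A B C, lt A B → lt B C → lt A C
  total : ∀ A B, lt A B ∨ A = B ∨ lt B A
  btw_iff : ∀ A B C : carrier,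
    Btw (A : P) (B : P) (C : P) ↔ (lt A B ∧ lt B C) ∨ (lt C B ∧ lt B A)

variable {P : Type*} [AbsolutePlane P]

/-- The group `T` of signed magnitudes, read off a reference ordered line `R`: the translations of
`R`, i.e. the order-preserving permutations of the points of `R` that take each segment to a
congruent one. Its operation is written multiplicatively (composition), its zero is `1`. -/
def Magnitudes (R : OrderedLine P) : Subgroup (Equiv.Perm R.carrier) where
  carrier := {t | (∀ A B : R.carrier, R.lt A B ↔ R.lt (t A) (t B)) ∧
    ∀ A B : R.carrier, Cong (A : P) (B : P) (t A : P) (t B : P)}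
  one_mem' := ⟨fun _ _ => Iff.rfl, fun A B => by
    have h := cong_swap (A : P) (B : P)
    exact cong_trans _ _ _ _ _ _ h (cong_symm _ _ _ _ h)⟩
  mul_mem' := fun {s t} hs ht =>
    ⟨fun A B => (ht.1 A B).trans (hs.1 (t A) (t B)),
      fun A B => cong_trans _ _ _ _ _ _ (ht.2 A B) (hs.2 (t A) (t B))⟩
  inv_mem' := fun {t} ht =>
    ⟨fun A B => by simpa using (ht.1 (t⁻¹ A) (t⁻¹ B)).symm,
      fun A B => by simpa using cong_symm _ _ _ _ (ht.2 (t⁻¹ A) (t⁻¹ B))⟩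

/-- The order of `T`. -/
def Magnitudes.Lt {R : OrderedLine P} (s t : Magnitudes R) : Prop :=
  ∀ X : R.carrier, R.lt (s.1 X) (t.1 X)

/-- The segment `AB` has the positive element `t` of `T` as its magnitude: `t` moves the points
of the reference line through segments congruent to `AB`, in the positive direction. -/
def HasMagnitude {R : OrderedLine P} (A B : P) (t : Magnitudes R) : Prop :=
  Magnitudes.Lt 1 t ∧ ∀ X : R.carrier, Cong A B (X : P) (t.1 X : P)

/-- The coordinatization of the ordered line `l` by `T` with zero at `O`: an order-preserving
bijection taking zero to `O`, such that the magnitude of a segment is the difference of the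
coordinates of its ends. -/
def IsCoordinatization (R l : OrderedLine P) (O : P) (c : Magnitudes R ≃ l.carrier) : Prop :=
  (c 1 : P) = O ∧
  (∀ s t, Magnitudes.Lt s t ↔ l.lt (c s) (c t)) ∧
  ∀ s t, Magnitudes.Lt s t → HasMagnitude (c s : P) (c t : P) (t * s⁻¹)

/-- The point `X` of `l` has coordinate `t` when `l` is coordinatized with zero at `O`. -/
def HasCoordinate (R l : OrderedLine P) (O X : P) (t : Magnitudes R) : Prop :=
  ∃ c : Magnitudes R ≃ l.carrier, IsCoordinatization R l O c ∧ (c t : P) = X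

/-- A system of axes: an ordered pair of perpendicular ordered lines; `O` is their intersection
point. -/
structure SystemOfAxes (P : Type*) [AbsolutePlane P] where
  l : OrderedLine P
  m : OrderedLine P
  O : P
  perp : PerpAt O l.carrier m.carrier

/-- The points of the two axes. -/
def SystemOfAxes.points (S : SystemOfAxes P) : Set P := S.l.carrier ∪ S.m.carrier

/-- The map `f` takes each point of an axis of `S` to the point of the corresponding axis of `S'`
that has the same coordinate. -/
def PreservesAxisCoordinates (R : OrderedLine P) (S S' : SystemOfAxes P)
    (f : S.points → S'.points) : Prop :=
  (∀ X : S.points, ∀ t, HasCoordinate R S.l S.O X t → HasCoordinate R S'.l S'.O (f X) t) ∧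
  (∀ X : S.points, ∀ t, HasCoordinate R S.m S.O X t → HasCoordinate R S'.m S'.O (f X) t)

/-- A rigid motion: a permutation of the points that takes each segment to a congruent one. -/
def IsRigidMotion (φ : Equiv.Perm P) : Prop := ∀ A B : P, Cong A B (φ A) (φ B)

end AbsolutePlane

namespace AbsolutePlane

open PlaneData

variable {P : Type*} [AbsolutePlane P]

/-! The map `f` is isometric on each axis because coordinates determine lengths
(`isometric_on_axis`). It is also isometric between the axes, since right triangles with congruent
legs have congruent hypotenuses (`hypotenuse_eq`). Take the origin and one further point on each
axis. Three successive motions, each the identity or the reflection in a perpendicular bisector,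
carry these points to their images (`exists_isRigidMotion`). A point is determined by its distances
from three non-collinear points (`eq_of_len_eq_three`), so this motion agrees with `f` on the axes
and is the only one that does.

The substance is that reflections exist and are isometries, obtained without congruence of angles.
Since a triangle has at most one right angle, right triangles satisfy the hypotenuse-leg criterion
(`leg_eq`), and the diagonals of a rhombus bisect each other if their lines meet
(`midpoint_eq_of_rhombus`). Hence the points equidistant from two given points form a line
(`mem_line_of_len_eq`, `len_eq_of_mem_line`), and copying a triangle across a line reflects its
vertex. Lengths are preserved by reflections because of the five segment property
(`LineIsometry.len_eq_of_len_eq`, used in `IsReflection.len_map`).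

On a single line, plane separation yields a linear order, and segment transport makes any two
ordered lines isometric with a prescribed value at one point (`OrderedLine.exists_isometry`). The
same fact gives the translations and the coordinates. -/

/-- Congruence of (possibly null) segments as a setoid on pairs of points. -/
def segmentSetoid (P : Type*) [AbsolutePlane P] : Setoid (P × P) where
  r a b := Cong a.1 a.2 b.1 b.2
  iseqv :=
    ⟨fun a => cong_trans _ _ _ _ _ _ (cong_swap a.1 a.2) (cong_swap a.2 a.1),
      fun h => cong_symm _ _ _ _ h, fun h h' => cong_trans _ _ _ _ _ _ h h'⟩

/-- The length of a segment: its congruence class. -/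
def len (A B : P) : Quotient (segmentSetoid P) := Quotient.mk _ (A, B)

theorem cong_iff {A B C D : P} : Cong A B C D ↔ len A B = len C D :=
  (Quotient.eq (r := segmentSetoid P) (x := (A, B)) (y := (C, D))).symm

theorem len_comm (A B : P) : len A B = len B A := cong_iff.1 (cong_swap A B)

theorem len_self (A B : P) : len A A = len B B := cong_iff.1 (cong_null A B)

theorem eq_of_len_eq_self {A B C : P} (h : len A B = len C C) : A = B :=
  cong_null_eq _ _ _ (cong_iff.2 h)

theorem ne_of_len_eq {A B C D : P} (h : len A B = len C D) (hn : C ≠ D) : A ≠ B := by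
  rintro rfl
  exact hn (eq_of_len_eq_self h.symm)

theorem len_add {A B C A' B' C' : P} (h : Btw A B C) (h' : Btw A' B' C')
    (h₁ : len A B = len A' B') (h₂ : len B C = len B' C') : len A C = len A' C' :=
  cong_iff.1 (cong_add _ _ _ _ _ _ h h' (cong_iff.2 h₁) (cong_iff.2 h₂))

theorem exists_openRay_len {A B C D : P} (hAB : A ≠ B) (hCD : C ≠ D) :
    ∃ X ∈ openRay C D, len C X = len A B := by
  obtain ⟨X, hX, -⟩ := cong_transport A B C D hAB hCD
  exact ⟨X, hX.1, cong_iff.1 hX.2⟩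

theorem openRay_len_unique {O A X Y : P} (hA : O ≠ A) (hX : X ∈ openRay O A)
    (hY : Y ∈ openRay O A) (h : len O X = len O Y) : X = Y :=
  (cong_transport O Y O A (Ne.symm hY.1) hA).unique ⟨hX, cong_iff.2 h⟩ ⟨hY, cong_iff.2 rfl⟩

/-! ### Incidence -/

/-- The line through two distinct points. -/
def line (A B : P) : Set P := {X | Coll A B X}

theorem lines_unique {l m : Set P} (hl : l ∈ lines) (hm : m ∈ lines) {A B : P} (h : A ≠ B)
    (hAl : A ∈ l) (hBl : B ∈ l) (hAm : A ∈ m) (hBm : B ∈ m) : l = m :=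
  (line_through A B h).unique ⟨hl, hAl, hBl⟩ ⟨hm, hAm, hBm⟩

theorem eq_line {l : Set P} (hl : l ∈ lines) {A B : P} (h : A ≠ B) (hA : A ∈ l) (hB : B ∈ l) :
    l = line A B := by
  ext X
  constructor
  · exact fun hX => ⟨l, hl, hA, hB, hX⟩
  · rintro ⟨m, hm, hAm, hBm, hX⟩
    rwa [lines_unique hl hm h hA hB hAm hBm]

theorem line_mem_lines {A B : P} (h : A ≠ B) : line A B ∈ lines (P := P) := by
  obtain ⟨l, ⟨hl, hA, hB⟩, -⟩ := line_through A B h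
  rwa [← eq_line hl h hA hB]

theorem left_mem_line {A B : P} (h : A ≠ B) : A ∈ line A B := by
  obtain ⟨l, ⟨hl, hA, hB⟩, -⟩ := line_through A B h
  rwa [← eq_line hl h hA hB]

theorem right_mem_line {A B : P} (h : A ≠ B) : B ∈ line A B := by
  obtain ⟨l, ⟨hl, hA, hB⟩, -⟩ := line_through A B h
  rwa [← eq_line hl h hA hB]

theorem meet_unique {l m : Set P} (hl : l ∈ lines) (hm : m ∈ lines) {A X Y : P}
    (hAl : A ∈ l) (hAm : A ∉ m) (hXl : X ∈ l) (hXm : X ∈ m) (hYl : Y ∈ l) (hYm : Y ∈ m) :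
    X = Y := by
  by_contra h
  exact hAm (lines_unique hl hm h hXl hYl hXm hYm ▸ hAl)

theorem exists_notMem {l : Set P} (hl : l ∈ lines) : ∃ X, X ∉ l := by
  obtain ⟨A, B, C, h⟩ := three_points (P := P)
  by_contra! hn
  exact h ⟨l, hl, hn A, hn B, hn C⟩

theorem exists_ne_mem {l : Set P} (hl : l ∈ lines) (O : P) : ∃ X ∈ l, X ≠ O := by
  obtain ⟨A, hA, B, hB, h⟩ := two_points l hl
  by_cases hO : A = O
  · exact ⟨B, hB, fun h' => h (hO.trans h'.symm)⟩
  · exact ⟨A, hA, hO⟩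

theorem btw_mem_mid {l : Set P} (hl : l ∈ lines) {A B C : P} (h : Btw A B C) (hA : A ∈ l)
    (hC : C ∈ l) : B ∈ l := by
  obtain ⟨m, hm, h1, h2, h3⟩ := btw_coll _ _ _ h
  rwa [lines_unique hl hm (btw_distinct _ _ _ h).2.2 hA hC h1 h3]

theorem btw_mem_right {l : Set P} (hl : l ∈ lines) {A B C : P} (h : Btw A B C) (hA : A ∈ l)
    (hB : B ∈ l) : C ∈ l := by
  obtain ⟨m, hm, h1, h2, h3⟩ := btw_coll _ _ _ h
  rwa [lines_unique hl hm (btw_distinct _ _ _ h).1 hA hB h1 h2]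

theorem btw_mem_left {l : Set P} (hl : l ∈ lines) {A B C : P} (h : Btw A B C) (hB : B ∈ l)
    (hC : C ∈ l) : A ∈ l :=
  btw_mem_right hl (btw_symm _ _ _ h) hC hB

/-! ### Sides of a line, betweenness on a line -/

/-- The line `l` has a point between `A` and `B`. -/
def Crosses (l : Set P) (A B : P) : Prop := ∃ X ∈ l, Btw A X B

/-- With a side recorded as a truth value, crossing becomes a parity condition, so Pasch-type
arguments reduce to propositional logic. -/
theorem exists_side {l : Set P} (hl : l ∈ lines) :
    ∃ s : P → Prop, ∀ A, A ∉ l → ∀ B, B ∉ l → (Crosses l A B ↔ ¬ (s A ↔ s B)) := by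
  obtain ⟨H, K, -, -, hd, hu, hH, hK, hc⟩ := separation l hl
  have hHl : ∀ X ∈ l, X ∉ H := fun X hX h =>
    (hu ▸ Set.mem_union_left K h : X ∈ lᶜ) hX
  have hKl : ∀ X ∈ l, X ∉ K := fun X hX h =>
    (hu ▸ Set.mem_union_right H h : X ∈ lᶜ) hX
  have hor : ∀ X, X ∉ l → X ∈ H ∨ X ∈ K := fun X hX => by
    have : X ∈ H ∪ K := hu ▸ hX
    exact this
  have hnot : ∀ X, X ∈ K → X ∉ H := fun X h h' => Set.disjoint_left.1 hd h' h
  refine ⟨fun X => X ∈ H, fun A hA B hB => ?_⟩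
  constructor
  · rintro ⟨X, hX, hb⟩ h
    rcases hor A hA with h1 | h1
    · exact hHl X hX (hH A h1 B (h.1 h1) X hb)
    · rcases hor B hB with h2 | h2
      · exact hnot A h1 (h.2 h2)
      · exact hKl X hX (hK A h1 B h2 X hb)
  · intro h
    rcases hor A hA with h1 | h1 <;> rcases hor B hB with h2 | h2
    · exact absurd (iff_of_true h1 h2) h
    · exact hc A h1 B h2
    · obtain ⟨X, hX, hb⟩ := hc B h2 A h1
      exact ⟨X, hX, btw_symm _ _ _ hb⟩
    · exact absurd (iff_of_false (hnot A h1) (hnot B h2)) h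

theorem sameSide_iff {l : Set P} {A B : P} :
    SameSide l A B ↔ A ∉ l ∧ B ∉ l ∧ ¬ Crosses l A B := by
  simp [SameSide, Crosses]

theorem crosses_at {k n : Set P} (hk : k ∈ lines) (hn : n ∈ lines) {X A B : P} (hXk : X ∈ k)
    (hXn : X ∈ n) (hA : A ∈ k) (hAn : A ∉ n) (hB : B ∈ k) : Crosses n A B ↔ Btw A X B := by
  constructor
  · rintro ⟨Y, hY, hb⟩
    rwa [meet_unique hk hn hA hAn hXk hXn (btw_mem_mid hk hb hA hB) hY]
  · exact fun h => ⟨X, hXn, h⟩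

/-- The two sides of `X` on `k` are cut out by the sides of any other line through `X`. -/
theorem exists_side_on_line {k : Set P} (hk : k ∈ lines) {X : P} (hX : X ∈ k) :
    ∃ s : P → Prop, ∀ A ∈ k, A ≠ X → ∀ B ∈ k, B ≠ X → (Btw A X B ↔ ¬ (s A ↔ s B)) := by
  obtain ⟨D, hD⟩ := exists_notMem hk
  have hne : X ≠ D := fun h => hD (h ▸ hX)
  have hn := line_mem_lines hne
  have hoff : ∀ A ∈ k, A ≠ X → A ∉ line X D := fun A hA hAX hAn => hAX
    (meet_unique hn hk (right_mem_line hne) hD hAn hA (left_mem_line hne) hX)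
  obtain ⟨s, hs⟩ := exists_side hn
  exact ⟨s, fun A hA hAX B hB hBX => by
    rw [← crosses_at hk hn hX (left_mem_line hne) hA (hoff A hA hAX) hB,
      hs A (hoff A hA hAX) B (hoff B hB hBX)]⟩

theorem btw_not' {A B C : P} (h : Btw A B C) : ¬ Btw B A C := fun h' =>
  btw_not _ _ _ (btw_symm _ _ _ h) (btw_symm _ _ _ h')

/-- Hilbert's argument. Take `D` off the line and `G` beyond `D` on the ray `BD`. If neither `A` nor
`C` is between the other two points, then `AD` meets the segment `CG` at some `E`, and `CD`
separates `A` from `E`, so `D` is between them. Hence `BD` separates `A` from `C`, which puts `B`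
between them. -/
theorem btw_trichotomy {k : Set P} (hk : k ∈ lines) {A B C : P} (hA : A ∈ k) (hB : B ∈ k)
    (hC : C ∈ k) (hAB : A ≠ B) (hBC : B ≠ C) (hAC : A ≠ C) :
    Btw A B C ∨ Btw B A C ∨ Btw A C B := by
  by_contra! hcon
  obtain ⟨h1, h2, h3⟩ := hcon
  obtain ⟨D, hD⟩ := exists_notMem hk
  have neD : ∀ X ∈ k, X ≠ D := fun X hX h => hD (h ▸ hX)
  obtain ⟨G, hG⟩ := btw_extend B D (neD B hB)
  have hDG := (btw_distinct _ _ _ hG).2.1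
  have hBG := (btw_distinct _ _ _ hG).2.2
  have off : ∀ X ∈ k, ∀ Y ∈ k, Y ≠ X → Y ∉ line X D := fun X hX Y hY hYX hYn => hYX
    (meet_unique (line_mem_lines (neD X hX)) hk (right_mem_line (neD X hX)) hD hYn hY
      (left_mem_line (neD X hX)) hX)
  have Goff : ∀ X ∈ k, X ≠ B → G ∉ line X D := fun X hX hXB hGn =>
    off X hX B hB hXB.symm (btw_mem_left (line_mem_lines (neD X hX)) hG
      (right_mem_line (neD X hX)) hGn)
  have hGB : G ∈ line B D :=
    btw_mem_right (line_mem_lines (neD B hB)) hG (left_mem_line (neD B hB))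
      (right_mem_line (neD B hB))
  have hGk : G ∉ k := fun h => hD (btw_mem_mid hk hG hB h)
  have hCG : C ≠ G := fun h => hGk (h ▸ hC)
  obtain ⟨s, hs⟩ := exists_side (line_mem_lines (neD A hA))
  obtain ⟨t, ht⟩ := exists_side (line_mem_lines (neD C hC))
  obtain ⟨u, hu⟩ := exists_side (line_mem_lines (neD B hB))
  have a1 := hs B (off A hA B hB hAB.symm) G (Goff A hA hAB)
  have a2 := hs B (off A hA B hB hAB.symm) C (off A hA C hC hAC.symm)
  have a3 := hs C (off A hA C hC hAC.symm) G (Goff A hA hAB)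
  have a4 : Crosses (line A D) B G := ⟨D, right_mem_line (neD A hA), hG⟩
  have a5 : ¬ Crosses (line A D) B C := by
    rwa [crosses_at hk (line_mem_lines (neD A hA)) hA (left_mem_line (neD A hA)) hB
      (off A hA B hB hAB.symm) hC]
  have a6 : Crosses (line A D) C G := by clear * - a1 a2 a3 a4 a5; tauto
  obtain ⟨E, hEl, hE⟩ := a6
  have hCGl := line_mem_lines hCG
  have hECG : E ∈ line C G :=
    btw_mem_mid hCGl hE (left_mem_line hCG) (right_mem_line hCG)
  have hEC := (btw_distinct _ _ _ hE).1
  have hEG := (btw_distinct _ _ _ hE).2.1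
  have hE_CD : E ∉ line C D := fun h => Goff C hC hBC.symm
    (btw_mem_right (line_mem_lines (neD C hC)) hE (left_mem_line (neD C hC)) h)
  have hE_BD : E ∉ line B D := fun h => off B hB C hC hBC.symm
    (btw_mem_left (line_mem_lines (neD B hB)) hE h hGB)
  have b1 := ht A (off C hC A hA hAC) B (off C hC B hB hBC)
  have b2 := ht B (off C hC B hB hBC) G (Goff C hC hBC.symm)
  have b3 := ht G (Goff C hC hBC.symm) E hE_CD
  have b4 := ht A (off C hC A hA hAC) E hE_CD
  have b5 : ¬ Crosses (line C D) A B := by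
    rwa [crosses_at hk (line_mem_lines (neD C hC)) hC (left_mem_line (neD C hC)) hA
      (off C hC A hA hAC) hB]
  have b6 : Crosses (line C D) B G := ⟨D, right_mem_line (neD C hC), hG⟩
  have b7 : ¬ Crosses (line C D) G E := by
    rw [crosses_at hCGl (line_mem_lines (neD C hC)) (left_mem_line hCG)
      (left_mem_line (neD C hC)) (right_mem_line hCG) (Goff C hC hBC.symm) hECG]
    exact fun h => btw_not _ _ _ (btw_symm _ _ _ hE) h
  have b8 : Crosses (line C D) A E := by clear * - b1 b2 b3 b4 b5 b6 b7; tauto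
  rw [crosses_at (line_mem_lines (neD A hA)) (line_mem_lines (neD C hC))
    (right_mem_line (neD A hA)) (right_mem_line (neD C hC)) (left_mem_line (neD A hA))
    (off C hC A hA hAC) hEl] at b8
  have c1 := hu A (off B hB A hA hAB) E hE_BD
  have c2 := hu E hE_BD C (off B hB C hC hBC.symm)
  have c3 := hu A (off B hB A hA hAB) C (off B hB C hC hBC.symm)
  have c4 : Crosses (line B D) A E := ⟨D, right_mem_line (neD B hB), b8⟩
  have c5 : ¬ Crosses (line B D) E C := by
    rw [crosses_at hCGl (line_mem_lines (neD B hB)) (right_mem_line hCG) hGB hECG hE_BD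
      (left_mem_line hCG)]
    exact fun h => btw_not _ _ _ hE (btw_symm _ _ _ h)
  have c6 : Crosses (line B D) A C := by clear * - c1 c2 c3 c4 c5; tauto
  rw [crosses_at hk (line_mem_lines (neD B hB)) hB (left_mem_line (neD B hB)) hA
    (off B hB A hA hAB) hC] at c6
  exact h1 c6

theorem btw_or_btw {A X C D : P} (h : Btw A X C) {k : Set P} (hk : k ∈ lines) (hA : A ∈ k)
    (hC : C ∈ k) (hD : D ∈ k) (hDX : D ≠ X) : Btw A X D ∨ Btw C X D := by
  obtain ⟨s, hs⟩ := exists_side_on_line hk (btw_mem_mid hk h hA hC)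
  have hne := btw_distinct _ _ _ h
  have h1 := hs A hA hne.1 C hC hne.2.1.symm
  have h2 := hs A hA hne.1 D hD hDX
  have h3 := hs C hC hne.2.1.symm D hD hDX
  tauto

theorem not_btw_and_btw {A X C D : P} (h : Btw A X C) (h' : Btw A X D) : ¬ Btw C X D := by
  intro h''
  obtain ⟨k, hk, hA, hX, hC⟩ := btw_coll _ _ _ h
  have hD := btw_mem_right hk h' hA hX
  obtain ⟨s, hs⟩ := exists_side_on_line hk hX
  have hne := btw_distinct _ _ _ h
  have hne' := btw_distinct _ _ _ h'
  have h1 := hs A hA hne.1 C hC hne.2.1.symm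
  have h2 := hs A hA hne.1 D hD hne'.2.1.symm
  have h3 := hs C hC hne.2.1.symm D hD hne'.2.1.symm
  tauto

theorem mem_openRay_iff {k : Set P} (hk : k ∈ lines) {O A X : P} (hO : O ∈ k) (hA : A ∈ k)
    (hAO : A ≠ O) : X ∈ openRay O A ↔ X ∈ k ∧ X ≠ O ∧ ¬ Btw X O A := by
  constructor
  · rintro ⟨hXO, rfl | h | h⟩
    · exact ⟨hA, hXO, fun h => (btw_distinct _ _ _ h).2.2 rfl⟩
    · exact ⟨btw_mem_mid hk h hO hA, hXO, btw_not' h⟩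
    · exact ⟨btw_mem_right hk h hO hA, hXO, fun h' => btw_not _ _ _ (btw_symm _ _ _ h)
        (h')⟩
  · rintro ⟨hX, hXO, h⟩
    refine ⟨hXO, ?_⟩
    by_cases hXA : X = A
    · exact Or.inl hXA
    · have := btw_trichotomy hk hO hX hA hXO.symm hXA hAO.symm
      tauto

/-! ### Orders of the points of a line -/

theorem exists_pos {k : Set P} (hk : k ∈ lines) {O E : P} (hO : O ∈ k)
    (hOE : O ≠ E) : ∃ pos : P → P → Prop, pos O E ∧
      (∀ X ∈ k, ∀ Y ∈ k, X ≠ Y → (pos X Y ↔ ¬ pos Y X)) ∧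
      ∀ A ∈ k, ∀ X ∈ k, ∀ C ∈ k, A ≠ X → C ≠ X → (Btw A X C ↔ ¬ (pos X A ↔ pos X C)) := by
  classical
  have hex : ∀ X : P, ∃ s : P → Prop, X ∈ k →
      ∀ A ∈ k, A ≠ X → ∀ B ∈ k, B ≠ X → (Btw A X B ↔ ¬ (s A ↔ s B)) := fun X => by
    by_cases hX : X ∈ k
    · obtain ⟨s, hs⟩ := exists_side_on_line hk hX
      exact ⟨s, fun _ => hs⟩
    · exact ⟨fun _ => True, fun h => absurd h hX⟩
  choose s hs using hex
  -- `pos X Y` says that `Y` is on the positive side of `X`. For `X = O` that is the side of `E`;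
  -- for other `X` it is the side of `O` exactly when `X` is not on the positive side of `O`.
  let pos : P → P → Prop := fun X Y =>
    if X = O then (s O Y ↔ s O E) else ((s X Y ↔ s X O) ↔ ¬ (s O X ↔ s O E))
  have hpO : ∀ Y, pos O Y ↔ (s O Y ↔ s O E) := fun Y => by simp [pos]
  have hpX : ∀ X Y, X ≠ O → (pos X Y ↔ ((s X Y ↔ s X O) ↔ ¬ (s O X ↔ s O E))) :=
    fun X Y h => by simp [pos, h]
  have hbtw : ∀ A ∈ k, ∀ X ∈ k, ∀ C ∈ k, A ≠ X → C ≠ X →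
      (Btw A X C ↔ ¬ (pos X A ↔ pos X C)) := fun A hA X hX C hC hAX hCX => by
    rw [hs X hX A hA hAX C hC hCX]
    by_cases hXO : X = O
    · subst hXO
      rw [hpO, hpO]
      tauto
    · rw [hpX X A hXO, hpX X C hXO]
      tauto
  have hposO : ∀ X, X ≠ O → (pos O X ↔ ¬ pos X O) := fun X hX => by
    rw [hpO, hpX X O hX]
    tauto
  refine ⟨pos, by simp [hpO], fun X hX Y hY hXY => ?_, hbtw⟩
  by_cases hXO : X = O
  · subst hXO
    exact hposO Y hXY.symm
  · by_cases hYO : Y = O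
    · subst hYO
      have := hposO X hXO
      tauto
    · have a1 := hbtw X hX O hO Y hY hXO hYO
      have a2 := hbtw O hO X hX Y hY (Ne.symm hXO) hXY.symm
      have a3 := hbtw O hO Y hY X hX (Ne.symm hYO) hXY
      have a4 := hposO X hXO
      have a5 := hposO Y hYO
      have t := btw_trichotomy hk hX hO hY hXO (Ne.symm hYO) hXY
      have t1 : Btw X O Y → ¬ Btw O X Y := btw_not'
      have t2 : Btw X O Y → ¬ Btw O Y X := fun h h' => btw_not _ _ _ h (btw_symm _ _ _ h')
      have t3 : Btw O X Y → ¬ Btw O Y X := btw_not _ _ _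
      have t4 : Btw X Y O ↔ Btw O Y X := ⟨btw_symm _ _ _, btw_symm _ _ _⟩
      clear * - a1 a2 a3 a4 a5 t t1 t2 t3 t4
      grind

theorem exists_orderedLine {k : Set P} (hk : k ∈ lines) {O E : P} (hO : O ∈ k)
    (hOE : O ≠ E) : ∃ L : OrderedLine P, L.carrier = k ∧
      ∀ A B : L.carrier, (A : P) = O → (B : P) = E → L.lt A B := by
  obtain ⟨pos, h0, h1, h2⟩ := exists_pos hk hO hOE
  refine ⟨⟨k, hk, fun X Y => (X : P) ≠ Y ∧ pos X Y, fun A h => h.1 rfl, ?_, ?_, ?_⟩, rfl, ?_⟩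
  · rintro ⟨A, hA⟩ ⟨B, hB⟩ ⟨C, hC⟩ ⟨hAB, hab⟩ ⟨hBC, hbc⟩
    dsimp only at *
    have b : Btw A B C := by
      rw [h2 A hA B hB C hC hAB hBC.symm]
      have := h1 A hA B hB hAB
      tauto
    have hAC := (btw_distinct _ _ _ b).2.2
    have b' := btw_not' b
    rw [h2 B hB A hA C hC hAB.symm hAC.symm] at b'
    exact ⟨hAC, by tauto⟩
  · rintro ⟨A, hA⟩ ⟨B, hB⟩
    by_cases hAB : A = B
    · subst hAB
      simp
    · have := h1 A hA B hB hAB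
      have hBA := Ne.symm hAB
      simp only [Subtype.mk.injEq]
      tauto
  · rintro ⟨A, hA⟩ ⟨B, hB⟩ ⟨C, hC⟩
    dsimp only
    by_cases hAB : A = B
    · subst hAB
      simp only [ne_eq, not_true_eq_false, false_and, and_false, or_self, iff_false]
      exact fun h => (btw_distinct _ _ _ h).1 rfl
    by_cases hBC : B = C
    · subst hBC
      simp only [ne_eq, not_true_eq_false, false_and, and_false, or_self, iff_false]
      exact fun h => (btw_distinct _ _ _ h).2.1 rfl
    have e1 := h1 A hA B hB hAB
    have e2 := h1 B hB C hC hBC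
    have e3 := h2 A hA B hB C hC hAB (Ne.symm hBC)
    have hBA := Ne.symm hAB
    have hCB := Ne.symm hBC
    clear * - e1 e2 e3 hAB hBC hBA hCB
    tauto
  · rintro A B rfl rfl
    exact ⟨hOE, h0⟩

/-! ### Isometries of ordered lines. -/

namespace OrderedLine

/-- The same line with the opposite order. -/
abbrev rev (L : OrderedLine P) : OrderedLine P where
  carrier := L.carrier
  isLine := L.isLine
  lt A B := L.lt B A
  irrefl := L.irrefl
  trans A B C h h' := L.trans _ _ _ h' h
  total A B := by
    rcases L.total A B with h | h | h
    · exact Or.inr (Or.inr h)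
    · exact Or.inr (Or.inl h)
    · exact Or.inl h
  btw_iff A B C := by
    rw [L.btw_iff]
    tauto

variable {L L' : OrderedLine P}

theorem btw_of_lt {A B C : L.carrier} (h : L.lt A B) (h' : L.lt B C) : Btw (A : P) B C :=
  (L.btw_iff _ _ _).2 (Or.inl ⟨h, h'⟩)

theorem ne_of_lt {A B : L.carrier} (h : L.lt A B) : (A : P) ≠ B := fun e => by
  rw [Subtype.ext e] at h
  exact L.irrefl _ h

theorem mem_openRay_of_lt {O A X : L.carrier} (hA : L.lt O A) (hX : L.lt O X) :
    (X : P) ∈ openRay (O : P) A := by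
  refine ⟨(ne_of_lt hX).symm, ?_⟩
  rcases L.total X A with h | rfl | h
  · exact Or.inr (Or.inl (btw_of_lt hX h))
  · exact Or.inl rfl
  · exact Or.inr (Or.inr (btw_of_lt hA h))

theorem eq_of_len_eq {O X Y : L.carrier} (hX : L.lt O X) (hY : L.lt O Y)
    (h : len (O : P) X = len (O : P) Y) : X = Y :=
  Subtype.ext (openRay_len_unique (ne_of_lt hX) (mem_openRay_of_lt hX hX)
    (mem_openRay_of_lt hX hY) h)

theorem exists_lt (O : L.carrier) : ∃ X : L.carrier, L.lt O X := by
  obtain ⟨A, hA, hAO⟩ := exists_ne_mem L.isLine (O : P)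
  rcases L.total O ⟨A, hA⟩ with h | h | h
  · exact ⟨_, h⟩
  · exact absurd (congrArg Subtype.val h).symm hAO
  · obtain ⟨C, hC⟩ := btw_extend A O hAO
    have hCk := btw_mem_right L.isLine hC hA O.2
    rcases (L.btw_iff ⟨A, hA⟩ O ⟨C, hCk⟩).1 hC with h' | h'
    · exact ⟨_, h'.2⟩
    · exact absurd (L.trans _ _ _ h h'.2) (L.irrefl _)

theorem exists_lt_len (O : L.carrier) {A B : P} (h : A ≠ B) :
    ∃ X : L.carrier, L.lt O X ∧ len (O : P) X = len A B := by
  obtain ⟨E, hE⟩ := exists_lt O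
  obtain ⟨X, hX, hl⟩ := exists_openRay_len h (ne_of_lt hE)
  have hXE := hX
  rw [mem_openRay_iff L.isLine O.2 E.2 (ne_of_lt hE).symm] at hX
  obtain ⟨hXk, hXO, hb⟩ := hX
  refine ⟨⟨X, hXk⟩, ?_, hl⟩
  rcases L.total O ⟨X, hXk⟩ with h' | h' | h'
  · exact h'
  · exact absurd (congrArg Subtype.val h').symm hXO
  · exact absurd (btw_of_lt h' hE) hb

/-- Subtraction follows from addition: lay off `BC` beyond `B'`; the sum has the length of `A'C'`,
so by uniqueness of transport it ends at `C'`. -/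
theorem len_sub {A B C : L.carrier} {A' B' C' : L'.carrier} (h₁ : L.lt A B) (h₂ : L.lt B C)
    (h₁' : L'.lt A' B') (h₂' : L'.lt A' C') (hAC : len (A : P) C = len (A' : P) C')
    (hAB : len (A : P) B = len (A' : P) B') :
    L'.lt B' C' ∧ len (B : P) C = len (B' : P) C' := by
  obtain ⟨D, hD, hl⟩ := exists_lt_len B' (ne_of_lt h₂)
  have := len_add (btw_of_lt h₁ h₂) (btw_of_lt h₁' hD) hAB hl.symm
  have hDC : D = C' := eq_of_len_eq (L'.trans _ _ _ h₁' hD) h₂' (this.symm.trans hAC)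
  subst hDC
  exact ⟨hD, hl.symm⟩

/-- `X` and `Y` are at the same distance from `O` and `O'`, in the same direction. -/
def SamePosition (O : L.carrier) (O' : L'.carrier) (X : L.carrier) (Y : L'.carrier) : Prop :=
  (L.lt O X ∧ L'.lt O' Y ∧ len (O : P) X = len (O' : P) Y) ∨
  (L.lt X O ∧ L'.lt Y O' ∧ len (O : P) X = len (O' : P) Y) ∨ (X = O ∧ Y = O')

theorem SamePosition.symm {O X : L.carrier} {O' Y : L'.carrier} (h : SamePosition O O' X Y) :
    SamePosition O' O Y X := by
  unfold SamePosition at *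
  grind

theorem exists_samePosition (O : L.carrier) (O' : L'.carrier) (X : L.carrier) :
    ∃ Y, SamePosition O O' X Y := by
  rcases L.total O X with h | h | h
  · obtain ⟨Y, hY, hl⟩ := exists_lt_len (L := L') O' (ne_of_lt h)
    exact ⟨Y, Or.inl ⟨h, hY, hl.symm⟩⟩
  · exact ⟨O', Or.inr (Or.inr ⟨h.symm, rfl⟩)⟩
  · obtain ⟨Y, hY, hl⟩ := exists_lt_len (L := L'.rev) O' (ne_of_lt h).symm
    exact ⟨Y, Or.inr (Or.inl ⟨h, hY, hl.symm⟩)⟩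

theorem SamePosition.lt {O X X₂ : L.carrier} {O' Y Y₂ : L'.carrier} (h : SamePosition O O' X Y)
    (h₂ : SamePosition O O' X₂ Y₂) (hlt : L.lt X X₂) :
    L'.lt Y Y₂ ∧ len (X : P) X₂ = len (Y : P) Y₂ := by
  rcases h with ⟨h1, h1', hl⟩ | ⟨h1, h1', hl⟩ | ⟨rfl, rfl⟩ <;>
    rcases h₂ with ⟨h2, h2', hl₂⟩ | ⟨h2, h2', hl₂⟩ | ⟨rfl, rfl⟩
  · exact len_sub h1 hlt h1' h2' hl₂ hl
  · exact absurd (L.trans _ _ _ (L.trans _ _ _ h1 hlt) h2) (L.irrefl _)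
  · exact absurd (L.trans _ _ _ h1 hlt) (L.irrefl _)
  · refine ⟨L'.trans _ _ _ h1' h2', ?_⟩
    rw [len_comm] at hl
    rw [len_comm (O' : P)] at hl
    exact len_add (btw_of_lt h1 h2) (btw_of_lt h1' h2') hl hl₂
  · have := len_sub (L := L.rev) (L' := L'.rev) h2 hlt h2' h1' hl hl₂
    rw [len_comm (X : P), len_comm (Y : P)]
    exact this
  · rw [len_comm (X : P), len_comm (Y : P)]
    exact ⟨h1', hl⟩
  · exact ⟨h2', hl₂⟩
  · exact absurd (L.trans _ _ _ hlt h2) (L.irrefl _)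
  · exact absurd hlt (L.irrefl _)

theorem SamePosition.eq {O X : L.carrier} {O' Y Y₂ : L'.carrier} (h : SamePosition O O' X Y)
    (h₂ : SamePosition O O' X Y₂) : Y = Y₂ := by
  rcases L'.total Y Y₂ with h' | h' | h'
  · exact absurd (h.symm.lt h₂.symm h').1 (L.irrefl _)
  · exact h'
  · exact absurd (h₂.symm.lt h.symm h').1 (L.irrefl _)

/-- Any two ordered lines are isometric, by an isometry with prescribed value at a point. -/
theorem exists_isometry (O : L.carrier) (O' : L'.carrier) :
    ∃ g : L.carrier ≃ L'.carrier, g O = O' ∧ (∀ A B, L.lt A B ↔ L'.lt (g A) (g B)) ∧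
      ∀ A B : L.carrier, len (A : P) B = len (g A : P) (g B) := by
  choose g hg using exists_samePosition O O'
  choose f hf using exists_samePosition O' O
  have hlt : ∀ A B, L.lt A B → L'.lt (g A) (g B) := fun A B h => ((hg A).lt (hg B) h).1
  refine ⟨⟨g, f, fun X => (hf (g X)).eq (hg X).symm, fun Y => (hg (f Y)).eq (hf Y).symm⟩,
    (hg O).eq (Or.inr (Or.inr ⟨rfl, rfl⟩)), fun A B => ⟨hlt A B, fun h => ?_⟩, fun A B => ?_⟩
  · dsimp at h
    rcases L.total A B with h' | rfl | h'
    · exact h'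
    · exact absurd h (L'.irrefl _)
    · exact absurd (L'.trans _ _ _ h (hlt _ _ h')) (L'.irrefl _)
  · dsimp
    rcases L.total A B with h' | rfl | h'
    · exact ((hg A).lt (hg B) h').2
    · exact len_self _ _
    · rw [len_comm (A : P), len_comm (g A : P)]
      exact ((hg B).lt (hg A) h').2

/-- An order preserving isometry is determined by its value at one point. -/
theorem isometry_unique {g h : L.carrier → L'.carrier} (hg : ∀ A B, L.lt A B → L'.lt (g A) (g B))
    (hg' : ∀ A B : L.carrier, len (A : P) B = len (g A : P) (g B))
    (hh : ∀ A B, L.lt A B → L'.lt (h A) (h B))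
    (hh' : ∀ A B : L.carrier, len (A : P) B = len (h A : P) (h B))
    {O : L.carrier} (hO : g O = h O) (X : L.carrier) : g X = h X := by
  rcases L.total O X with hX | rfl | hX
  · refine eq_of_len_eq (hg _ _ hX) (hO ▸ hh _ _ hX) ?_
    rw [← hg' O X, hO, ← hh' O X]
  · exact hO
  · refine eq_of_len_eq (L := L'.rev) (hg _ _ hX) (hO ▸ hh _ _ hX) ?_
    rw [← hg' O X, hO, ← hh' O X]

/-- The order reversing isometry with `A ↦ C` swaps `A` and `C` and takes `B` to a point between
them at distance `BC` from `A`. If `BC` had the length of `AD`, that point would be `D`, which lies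
beyond `C`. -/
theorem len_ne_of_nested {A B C D : L.carrier} (h₁ : L.lt A B) (h₂ : L.lt B C)
    (h₃ : L.lt C D) : len (B : P) C ≠ len (A : P) D := by
  intro h
  obtain ⟨g, hgA, hlt, hlen⟩ := exists_isometry (L := L) (L' := L.rev) A C
  have hAC := L.trans _ _ _ h₁ h₂
  have hgC : g C = A := by
    refine eq_of_len_eq (L := L.rev) (O := C) (hgA ▸ (hlt A C).1 hAC) hAC ?_
    rw [len_comm (C : P) A, hlen A C, hgA]
  have hW : L.lt (g B) C := hgA ▸ (hlt A B).1 h₁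
  have hW' : L.lt A (g B) := hgC ▸ (hlt B C).1 h₂
  have : g B = D := by
    refine eq_of_len_eq (L := L) hW' (L.trans _ _ _ hAC h₃) ?_
    rw [← h, hlen B C, hgC, len_comm]
  rw [this] at hW
  exact L.irrefl _ (L.trans _ _ _ h₃ hW)

end OrderedLine

/-! ### Isometries between lines, uniqueness of midpoints. -/

/-- An isometry of the line `k` into the line `k'` (its values off `k` are irrelevant). -/
structure LineIsometry (k k' : Set P) (g : P → P) : Prop where
  mem : ∀ X ∈ k, g X ∈ k'
  len_eq : ∀ X ∈ k, ∀ Y ∈ k, len X Y = len (g X) (g Y)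
  btw : ∀ X ∈ k, ∀ Y ∈ k, ∀ Z ∈ k, (Btw X Y Z ↔ Btw (g X) (g Y) (g Z))

/-- Order the lines so that `A` precedes `B` and `A'` precedes `B'`; the order preserving isometry
with `A ↦ A'` then takes `B` to `B'`. -/
theorem exists_lineIsometry {k k' : Set P} (hk : k ∈ lines) (hk' : k' ∈ lines) {A B A' B' : P}
    (hA : A ∈ k) (hB : B ∈ k) (hA' : A' ∈ k') (hB' : B' ∈ k') (hAB : A ≠ B)
    (h : len A B = len A' B') : ∃ g, LineIsometry k k' g ∧ g A = A' ∧ g B = B' := by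
  classical
  have hAB' : A' ≠ B' := ne_of_len_eq h.symm hAB
  obtain ⟨L, rfl, hL⟩ := exists_orderedLine hk hA hAB
  obtain ⟨L', rfl, hL'⟩ := exists_orderedLine hk' hA' hAB'
  obtain ⟨g, hgA, hlt, hlen⟩ := OrderedLine.exists_isometry (⟨A, hA⟩ : L.carrier)
    (⟨A', hA'⟩ : L'.carrier)
  have hgB : g ⟨B, hB⟩ = ⟨B', hB'⟩ := by
    refine OrderedLine.eq_of_len_eq (O := ⟨A', hA'⟩) (hgA ▸ (hlt ⟨A, hA⟩ ⟨B, hB⟩).1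
      (hL _ _ rfl rfl)) (hL' _ _ rfl rfl) ?_
    have := hlen ⟨A, hA⟩ ⟨B, hB⟩
    rw [hgA] at this
    exact this.symm.trans h
  let f : P → P := fun X => if hX : X ∈ L.carrier then (g ⟨X, hX⟩ : P) else X
  have hf : ∀ X (hX : X ∈ L.carrier), f X = g ⟨X, hX⟩ := fun X hX => by simp [f, hX]
  refine ⟨f, ⟨fun X hX => ?_, fun X hX Y hY => ?_, fun X hX Y hY Z hZ => ?_⟩, ?_, ?_⟩
  · rw [hf X hX]
    exact (g ⟨X, hX⟩).2
  · rw [hf X hX, hf Y hY]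
    exact hlen ⟨X, hX⟩ ⟨Y, hY⟩
  · rw [hf X hX, hf Y hY, hf Z hZ, L'.btw_iff, ← hlt, ← hlt, ← hlt, ← hlt, ← L.btw_iff]
  · rw [hf A hA, hgA]
  · rw [hf B hB, hgB]

/-- The order reversing isometry with `B ↦ C` fixes every midpoint of `BC`, but it cannot fix two
points. -/
theorem midpoint_unique {M N B C : P} (hM : IsMidpoint M B C) (hN : IsMidpoint N B C) :
    M = N := by
  obtain ⟨hMb, hMl⟩ := hM
  obtain ⟨hNb, hNl⟩ := hN
  rw [cong_iff] at hMl hNl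
  have hBC := (btw_distinct _ _ _ hMb).2.2
  obtain ⟨L, hL, hlt⟩ := exists_orderedLine (line_mem_lines hBC) (left_mem_line hBC) hBC
  have hB : B ∈ L.carrier := hL ▸ left_mem_line hBC
  have hC : C ∈ L.carrier := hL ▸ right_mem_line hBC
  lift B to L.carrier using hB
  lift C to L.carrier using hC
  lift M to L.carrier using btw_mem_mid L.isLine hMb B.2 C.2
  lift N to L.carrier using btw_mem_mid L.isLine hNb B.2 C.2
  have hBC' := hlt B C rfl rfl
  have key : ∀ X : L.carrier, Btw (B : P) X C → L.lt B X ∧ L.lt X C := fun X h => by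
    rcases (L.btw_iff _ _ _).1 h with h | h
    · exact h
    · exact absurd (L.trans _ _ _ (L.trans _ _ _ h.1 h.2) hBC') (L.irrefl _)
  obtain ⟨g, hgB, hg, hlen⟩ := OrderedLine.exists_isometry (L := L) (L' := L.rev) B C
  have fix : ∀ X : L.carrier, Btw (B : P) X C → len (X : P) B = len (X : P) C → g X = X :=
    fun X h hl => by
      refine OrderedLine.eq_of_len_eq (L := L.rev) (O := C) (hgB ▸ (hg B X).1 (key X h).1)
        (key X h).2 ?_
      rw [len_comm (C : P) X, ← hl, len_comm (X : P), hlen B X, hgB]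
  have h1 := fix M hMb hMl
  have h2 := fix N hNb hNl
  rcases L.total M N with h | h | h
  · have := (hg _ _).1 h
    rw [h1, h2] at this
    exact absurd (L.trans _ _ _ h this) (L.irrefl _)
  · rw [h]
  · have := (hg _ _).1 h
    rw [h1, h2] at this
    exact absurd (L.trans _ _ _ h this) (L.irrefl _)

/-! ### Right angles and perpendicular bisectors -/

theorem line_comm (A B : P) : line A B = line B A := by
  ext X
  exact ⟨fun ⟨l, hl, h1, h2, h3⟩ => ⟨l, hl, h2, h1, h3⟩,
    fun ⟨l, hl, h1, h2, h3⟩ => ⟨l, hl, h2, h1, h3⟩⟩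

theorem notMem_line_of_ne {l : Set P} (hl : l ∈ lines) {A B X : P} (hX : X ∈ l) (hA : A ∈ l)
    (hB : B ∉ l) (h : X ≠ A) : X ∉ line A B := fun hX' =>
  have hAB : A ≠ B := fun e => hB (e ▸ hA)
  h (meet_unique (line_mem_lines hAB) hl (right_mem_line hAB) hB hX' hX (left_mem_line hAB) hA)

theorem _root_.PlaneData.IsMidpoint.len_eq {M B C : P} (h : IsMidpoint M B C) : len M B = len M C :=
  cong_iff.1 h.2

theorem _root_.PlaneData.IsMidpoint.symm {M B C : P} (h : IsMidpoint M B C) : IsMidpoint M C B :=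
  ⟨btw_symm _ _ _ h.1, cong_symm _ _ _ _ h.2⟩

theorem _root_.PlaneData.IsMidpoint.ne {M B C : P} (h : IsMidpoint M B C) : B ≠ C := (btw_distinct _ _ _ h.1).2.2

theorem _root_.PlaneData.IsMidpoint.ne_left {M B C : P} (h : IsMidpoint M B C) : B ≠ M :=
  (btw_distinct _ _ _ h.1).1

theorem _root_.PlaneData.IsMidpoint.mem_line {M B C : P} (h : IsMidpoint M B C) : M ∈ line B C :=
  btw_mem_mid (line_mem_lines h.ne) h.1 (left_mem_line h.ne) (right_mem_line h.ne)

theorem isMidpoint_of_len_eq {E C D : P} (hCD : C ≠ D) (hE : E ∈ line C D)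
    (h : len E C = len E D) : IsMidpoint E C D := by
  have hEC : E ≠ C := fun e => by
    subst e
    exact hCD (eq_of_len_eq_self h.symm)
  have hED : E ≠ D := fun e => by
    subst e
    exact hCD.symm (eq_of_len_eq_self h)
  refine ⟨?_, cong_iff.2 h⟩
  by_contra hb
  have hl := line_mem_lines hCD
  have hray : C ∈ openRay E D :=
    (mem_openRay_iff hl hE (right_mem_line hCD) hED.symm).2 ⟨left_mem_line hCD, hEC.symm, hb⟩
  exact hCD (openRay_len_unique hED hray ⟨hED.symm, Or.inl rfl⟩ h)

theorem eq_midpoint {E M C D : P} (hM : IsMidpoint M C D) (hE : E ∈ line C D)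
    (h : len E C = len E D) : E = M :=
  midpoint_unique (isMidpoint_of_len_eq hM.ne hE h) hM

theorem self_mem_openRay {O A : P} (h : A ≠ O) : A ∈ openRay O A := ⟨h, Or.inl rfl⟩

theorem mem_openRay_comm {O A X : P} (h : A ≠ O) (hX : X ∈ openRay O A) : A ∈ openRay O X := by
  refine ⟨h, ?_⟩
  rcases hX.2 with h' | h' | h'
  · exact Or.inl h'.symm
  · exact Or.inr (Or.inr h')
  · exact Or.inr (Or.inl h')

theorem _root_.PlaneData.IsRightAngle.symm {A M B : P} (h : IsRightAngle A M B) :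
    IsRightAngle B M A :=
  ⟨h.2.1, h.1, h.2.2.symm⟩

theorem hypotenuse_eq {A M B A' M' B' : P} (h : IsRightAngle A M B) (h' : IsRightAngle A' M' B')
    (h₁ : len M A = len M' A') (h₂ : len M B = len M' B') : len A B = len A' B' :=
  cong_iff.1 (right_angles A M B A' M' B' h h' (cong_iff.2 h₁) (cong_iff.2 h₂))

theorem exists_mem_openRay_of_midpoint {M B C X : P} (hM : IsMidpoint M B C)
    (hX : X ∈ line B C) (h : X ≠ M) : X ∈ openRay M B ∨ X ∈ openRay M C := by
  have hl := line_mem_lines hM.ne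
  rw [mem_openRay_iff hl hM.mem_line (left_mem_line hM.ne) hM.ne_left,
    mem_openRay_iff hl hM.mem_line (right_mem_line hM.ne) hM.symm.ne_left]
  by_cases hb : Btw X M B
  · exact Or.inr ⟨hX, h, not_btw_and_btw (btw_symm _ _ _ hb) hM.1⟩
  · exact Or.inl ⟨hX, h, hb⟩

/-- Supplies an end of the segment that spans the same ray from `X` as `M` does, so that a right
angle at `X` can be transferred to the side through `M`. -/
theorem mem_openRay_of_midpoint {M B C X : P} (hM : IsMidpoint M B C)
    (hX : X ∈ line B C) (h : X ≠ M) :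
    (B ≠ X ∧ M ∈ openRay X B) ∨ (C ≠ X ∧ M ∈ openRay X C) := by
  have hl := line_mem_lines hM.ne
  rcases exists_mem_openRay_of_midpoint hM hX h with h' | h'
  · right
    have hCX : C ≠ X := by
      rintro rfl
      have := (mem_openRay_iff hl hM.mem_line (left_mem_line hM.ne) hM.ne_left).1 h'
      exact this.2.2 (btw_symm _ _ _ hM.1)
    refine ⟨hCX, (mem_openRay_iff hl hX (right_mem_line hM.ne) hCX).2
      ⟨hM.mem_line, h.symm, fun hb => ?_⟩⟩
    have h1 := ((mem_openRay_iff hl hM.mem_line (left_mem_line hM.ne) hM.ne_left).1 h').2.2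
    have := (btw_or_btw hM.1 hl (left_mem_line hM.ne) (right_mem_line hM.ne) hX h)
    rcases this with h2 | h2
    · exact h1 (btw_symm _ _ _ h2)
    · exact btw_not _ _ _ (btw_symm _ _ _ hb) h2
  · left
    have hBX : B ≠ X := by
      rintro rfl
      have := (mem_openRay_iff hl hM.mem_line (right_mem_line hM.ne) hM.symm.ne_left).1 h'
      exact this.2.2 hM.1
    refine ⟨hBX, (mem_openRay_iff hl hX (left_mem_line hM.ne) hBX).2
      ⟨hM.mem_line, h.symm, fun hb => ?_⟩⟩
    have h1 := ((mem_openRay_iff hl hM.mem_line (right_mem_line hM.ne) hM.symm.ne_left).1 h').2.2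
    have := (btw_or_btw hM.1 hl (left_mem_line hM.ne) (right_mem_line hM.ne) hX h)
    rcases this with h2 | h2
    · exact btw_not _ _ _ (btw_symm _ _ _ hb) h2
    · exact h1 (btw_symm _ _ _ h2)

theorem isRightAngle_of_mem_openRay {A M B C X Y : P} (hM : IsMidpoint M B C)
    (hA : A ∉ line B C) (h : len A B = len A C) (hX : X ∈ openRay M B) (hY : Y ∈ openRay M A) :
    IsRightAngle Y M X := by
  have hAM : A ≠ M := fun e => hA (e ▸ hM.mem_line)
  exact ⟨hY.1, hX.1, Or.inl ⟨A, mem_openRay_comm hAM hY, B, mem_openRay_comm hM.ne_left hX, C,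
    fun ⟨l, hl, h1, h2, h3⟩ => hA ⟨l, hl, h2, h3, h1⟩, hM, cong_iff.2 h⟩⟩

/-- A point off a line that is equidistant from two points of the line is joined to their midpoint
by a perpendicular. -/
theorem isRightAngle_midpoint {A M B C X Y : P} (hM : IsMidpoint M B C) (hA : A ∉ line B C)
    (h : len A B = len A C) (hX : X ∈ line B C) (hXM : X ≠ M) (hY : Y ∈ openRay M A) :
    IsRightAngle Y M X := by
  rcases exists_mem_openRay_of_midpoint hM hX hXM with h' | h'
  · exact isRightAngle_of_mem_openRay hM hA h h' hY
  · exact isRightAngle_of_mem_openRay hM.symm (line_comm B C ▸ hA) h.symm h' hY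

theorem isRightAngle_midpoint_self {A M B C X : P} (hM : IsMidpoint M B C) (hA : A ∉ line B C)
    (h : len A B = len A C) (hX : X ∈ line B C) (hXM : X ≠ M) : IsRightAngle A M X :=
  isRightAngle_midpoint hM hA h hX hXM (self_mem_openRay fun e => hA (e ▸ hM.mem_line))

/-- A right angle stays right when one of its sides is represented by another point. -/
theorem _root_.PlaneData.IsRightAngle.of_mem_openRay {A M B X : P} (h : IsRightAngle A M B)
    (hX : X ∈ openRay M A) : IsRightAngle X M B := by
  have key : ∀ Z ∈ openRay M A, Z ∈ openRay M X := fun Z hZ => by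
    obtain ⟨hAM, -⟩ := h
    have hl := line_mem_lines hAM.symm
    have hMl := left_mem_line hAM.symm
    have hAl := right_mem_line hAM.symm
    rw [mem_openRay_iff hl hMl hAl hAM] at hX hZ
    rw [mem_openRay_iff hl hMl hX.1 hX.2.1]
    refine ⟨hZ.1, hZ.2.1, fun hb => ?_⟩
    rcases btw_or_btw hb hl hZ.1 hX.1 hAl hAM with h' | h'
    · exact hZ.2.2 h'
    · exact hX.2.2 h'
  refine ⟨hX.1, h.2.1, ?_⟩
  rcases h.2.2 with ⟨A₀, hA₀, h'⟩ | ⟨B₀, hB₀, A₀, hA₀, h'⟩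
  · exact Or.inl ⟨A₀, key A₀ hA₀, h'⟩
  · exact Or.inr ⟨B₀, hB₀, A₀, key A₀ hA₀, h'⟩

theorem not_isRightAngle_isRightAngle {A B C : P} (hC : C ∉ line A B)
    (h : IsRightAngle C A B) : ¬ IsRightAngle C B A := fun h' =>
  one_right_angle A B C hC ⟨h.symm, h'.symm⟩

/-- Right triangles with congruent hypotenuses and a pair of congruent legs have their other legs
congruent. -/
theorem leg_eq {A K C A' K' C' : P} (h : IsRightAngle A K C) (h' : IsRightAngle A' K' C')
    (hC : C' ∉ line K' A') (h₁ : len K C = len K' C') (h₂ : len A C = len A' C') :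
    len K A = len K' A' := by
  obtain ⟨D, hD, hDl⟩ := exists_openRay_len h.1.symm h'.1.symm
  have hDC : len D C' = len A' C' := by
    rw [← h₂]
    exact hypotenuse_eq (h'.of_mem_openRay hD) h (by rw [hDl]) h₁.symm
  by_cases hDA : D = A'
  · rw [← hDl, hDA]
  exfalso
  have hl := line_mem_lines h'.1.symm
  have hK'l := left_mem_line h'.1.symm
  have hA'l := right_mem_line h'.1.symm
  have hD' := (mem_openRay_iff hl hK'l hA'l h'.1).1 hD
  have hline : line K' A' = line D A' := eq_line hl hDA hD'.1 hA'l
  -- `C'` is equidistant from `D` and `A'`, so the angle at `L` is right; the triangle `C'LK'` then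
  -- has right angles at both `L` and `K'`.
  obtain ⟨L, hL⟩ := midpoint D A' hDA
  have hLl : L ∈ line K' A' := hline ▸ hL.mem_line
  have hLK : L ≠ K' := by
    rintro rfl
    exact hD'.2.2 hL.1
  have hLray : L ∈ openRay K' A' := by
    refine (mem_openRay_iff hl hK'l hA'l h'.1).2 ⟨hLl, hLK, fun hb => ?_⟩
    rcases btw_or_btw hb hl hLl hA'l hD'.1 hD'.2.1 with h3 | h3
    · obtain ⟨s, hs⟩ := exists_side_on_line hl hLl
      have e1 := (hs D hD'.1 hL.ne_left A' hA'l hL.symm.ne_left).1 hL.1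
      have e2 := hs D hD'.1 hL.ne_left K' hK'l hLK.symm
      have e3 := hs A' hA'l hL.symm.ne_left K' hK'l hLK.symm
      have e4 : ¬ Btw D L K' := fun h6 => btw_not _ _ _ (btw_symm _ _ _ h3)
        h6
      have e5 : ¬ Btw A' L K' := fun h6 => btw_not _ _ _ (btw_symm _ _ _ hb)
        h6
      tauto
    · exact hD'.2.2 (btw_symm _ _ _ h3)
  have r1 := isRightAngle_midpoint_self hL (hline ▸ hC) (by rw [len_comm C', len_comm C', hDC])
    (hline ▸ hK'l) hLK.symm
  have r2 := h'.of_mem_openRay hLray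
  refine not_isRightAngle_isRightAngle ?_ r1 r2.symm
  rwa [← eq_line hl hLK hLl hK'l]

/-! ### Rhombi and perpendicular bisectors. -/

/-- If `K ≠ M`, the triangle `AKM` has a right angle at `M`, as `A` is equidistant from `C` and `D`,
and one at `K`, as `C` and `D` are equidistant from `A` and `B`. -/
theorem midpoint_eq_of_mem {A B C D K M : P} (hM : IsMidpoint M C D) (hK : IsMidpoint K A B)
    (h₁ : len A C = len A D) (h₂ : len C A = len C B) (h₃ : len D A = len D B)
    (hA : A ∉ line C D) (hKl : K ∈ line C D) : K = M := by
  by_contra hKM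
  have r1 := isRightAngle_midpoint_self hM hA h₁ hKl hKM
  have hl := line_mem_lines hK.ne
  have hl' := line_mem_lines hM.ne
  have aux : ∀ E, E ∈ line C D → E ≠ K → E ∉ line A B := fun E hE hEK hEl => hEK
    (meet_unique hl hl' (left_mem_line hK.ne) hA hEl hE hK.mem_line hKl)
  have r2 : IsRightAngle M K A := by
    rcases mem_openRay_of_midpoint hM hKl hKM with ⟨h, h'⟩ | ⟨h, h'⟩
    · exact isRightAngle_midpoint hK (aux C (left_mem_line hM.ne) h) h₂ (left_mem_line hK.ne)
        hK.ne_left h'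
    · exact isRightAngle_midpoint hK (aux D (right_mem_line hM.ne) h) h₃ (left_mem_line hK.ne)
        hK.ne_left h'
  refine not_isRightAngle_isRightAngle ?_ r2.symm r1
  rwa [← eq_line hl' hKM hKl hM.mem_line]

/-- The diagonals of a rhombus bisect each other as soon as their lines meet. -/
theorem midpoint_eq_of_rhombus {A B C D K M Q : P} (hM : IsMidpoint M C D)
    (hK : IsMidpoint K A B) (h₁ : len A C = len A D) (h₂ : len B C = len A C)
    (h₃ : len B D = len A C) (hA : A ∉ line C D) (hQ : Q ∈ line C D) (hQ' : Q ∈ line A B) :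
    K = M := by
  have e₁ : len C A = len C B := by rw [len_comm C, len_comm C, h₂]
  have e₂ : len D A = len D B := by rw [len_comm D, len_comm D, h₃, h₁]
  have e₃ : len B C = len B D := by rw [h₂, h₃]
  by_cases hKl : K ∈ line C D
  · exact midpoint_eq_of_mem hM hK h₁ e₁ e₂ hA hKl
  have hC : C ∉ line A B := fun h => hKl (eq_midpoint hK h e₁ ▸ left_mem_line hM.ne)
  have hD : D ∉ line A B := fun h => hKl (eq_midpoint hK h e₂ ▸ right_mem_line hM.ne)
  by_cases hMl : M ∈ line A B
  · exact (midpoint_eq_of_mem hK hM e₁ h₁ e₃ hC hMl).symm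
  exfalso
  have hB : B ∉ line C D := fun h => hMl (eq_midpoint hM h e₃ ▸ right_mem_line hK.ne)
  have hKM : K ≠ M := fun h => hMl (h ▸ hK.mem_line)
  have hQM : Q ≠ M := fun h => hMl (h ▸ hQ')
  have hQK : Q ≠ K := fun h => hKl (h ▸ hQ)
  have hAK : A ≠ K := hK.ne_left
  have hl := line_mem_lines hK.ne
  have hl' := line_mem_lines hM.ne
  -- The right triangles `AKC` and `AKD` share a leg and have congruent hypotenuses; `f₂` is the
  -- same for the other diagonal.
  have f₁ : len K C = len K D := by
    refine leg_eq (isRightAngle_midpoint_self hK hC e₁ (left_mem_line hK.ne) hAK)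
      (isRightAngle_midpoint_self hK hD e₂ (left_mem_line hK.ne) hAK) ?_ rfl ?_
    · exact notMem_line_of_ne hl (left_mem_line hK.ne) hK.mem_line hD hAK
    · rw [len_comm C, len_comm D, h₁]
  have f₂ : len M A = len M B := by
    refine leg_eq (isRightAngle_midpoint_self hM hA h₁ (left_mem_line hM.ne) hM.ne_left)
      (isRightAngle_midpoint_self hM hB e₃ (left_mem_line hM.ne) hM.ne_left) ?_ rfl h₂.symm
    exact notMem_line_of_ne hl' (left_mem_line hM.ne) hM.mem_line hB hM.ne_left
  -- Now `KM` is perpendicular to both diagonals, so the triangle `MKQ` has two right angles.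
  have r1 := isRightAngle_midpoint_self hM hKl f₁ hQ hQM
  have r2 := isRightAngle_midpoint_self hK hMl f₂ hQ' hQK
  exact one_right_angle M K Q (fun ⟨l, hl, h1, h2, h3⟩ => hKl
    (lines_unique hl hl' hQM.symm h1 h3 hM.mem_line hQ ▸ h2)) ⟨r1, r2⟩

theorem crosses_of_crosses_of_sameSide {l : Set P} (hl : l ∈ lines) {A B C : P} (hA : A ∉ l)
    (h : Crosses l A B) (hs : SameSide l B C) : Crosses l A C := by
  rw [sameSide_iff] at hs
  obtain ⟨s, hs'⟩ := exists_side hl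
  have e1 := hs' A hA B hs.1
  have e2 := hs' B hs.1 C hs.2.1
  have e3 := hs' A hA C hs.2.1
  tauto

theorem sameSide_of_crosses_of_crosses {l : Set P} (hl : l ∈ lines) {A B C : P} (hA : A ∉ l)
    (hB : B ∉ l) (hC : C ∉ l) (h : Crosses l A B) (h' : Crosses l A C) : SameSide l B C := by
  rw [sameSide_iff]
  obtain ⟨s, hs'⟩ := exists_side hl
  have e1 := hs' A hA B hB
  have e2 := hs' B hB C hC
  have e3 := hs' A hA C hC
  tauto

theorem Crosses.exists_mem_line {l : Set P} {A B : P} (h : Crosses l A B) :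
    ∃ Q ∈ l, Q ∈ line A B := by
  obtain ⟨Q, hQ, hb⟩ := h
  have hAB := (btw_distinct _ _ _ hb).2.2
  exact ⟨Q, hQ, btw_mem_mid (line_mem_lines hAB) hb (left_mem_line hAB) (right_mem_line hAB)⟩

theorem exists_crosses {l : Set P} (hl : l ∈ lines) {A : P} (hA : A ∉ l) :
    ∃ B, B ∉ l ∧ Crosses l A B := by
  obtain ⟨M, hM, -⟩ := two_points l hl
  obtain ⟨B, hB⟩ := btw_extend A M (fun e => hA (e ▸ hM))
  exact ⟨B, fun h => hA (btw_mem_left hl hB hM h), M, hM, hB⟩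

theorem exists_opposite {A C D M : P} (hM : IsMidpoint M C D) (hA : A ∉ line C D)
    (h : len A C = len A D) : ∃ B, B ∉ line C D ∧ Crosses (line C D) A B ∧ IsMidpoint M A B ∧
      len B C = len A C ∧ len B D = len A C := by
  have hl := line_mem_lines hM.ne
  obtain ⟨X, hX, hAX⟩ := exists_crosses hl hA
  obtain ⟨B, hXB, h1, h2⟩ := triangle_transport C D A C D (line C D) hl hA
    (left_mem_line hM.ne) (right_mem_line hM.ne) (cong_iff.2 rfl) X hX
  have hAB := crosses_of_crosses_of_sameSide hl hA hAX hXB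
  have hne : A ≠ B := by
    obtain ⟨Q, -, hb⟩ := hAB
    exact (btw_distinct _ _ _ hb).2.2
  rw [cong_iff, len_comm, len_comm C A] at h1
  rw [cong_iff, len_comm, len_comm D A, ← h] at h2
  obtain ⟨K, hK⟩ := midpoint A B hne
  obtain ⟨Q, hQ, hQ'⟩ := hAB.exists_mem_line
  have := midpoint_eq_of_rhombus hM hK h h1 h2 hA hQ hQ'
  exact ⟨B, hXB.2.1, hAB, this ▸ hK, h1, h2⟩

/-- All points off `CD` that are equidistant from `C` and `D` are collinear with the midpoint. -/
theorem mem_line_of_len_eq {A B C D M : P} (hM : IsMidpoint M C D) (hA : A ∉ line C D)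
    (h : len A C = len A D) (hB : B ∉ line C D) (h' : len B C = len B D) : B ∈ line M A := by
  have hl := line_mem_lines hM.ne
  have hMA : M ≠ A := fun e => hA (e ▸ hM.mem_line)
  have hMB : M ≠ B := fun e => hB (e ▸ hM.mem_line)
  -- `E` is placed on the ray `MB` at distance `MA`, so that `A`, `C`, `E`, `D` form a rhombus to
  -- which the lemma on diagonals applies.
  obtain ⟨E, hE, hEl⟩ := exists_openRay_len hMA hMB
  have hCM := hM.ne_left
  have hDM := hM.symm.ne_left
  have f1 : len E C = len A C := hypotenuse_eq
    (isRightAngle_midpoint hM hB h' (left_mem_line hM.ne) hCM hE)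
    (isRightAngle_midpoint_self hM hA h (left_mem_line hM.ne) hCM) hEl rfl
  have f2 : len E D = len A C := (hypotenuse_eq
    (isRightAngle_midpoint hM hB h' (right_mem_line hM.ne) hDM hE)
    (isRightAngle_midpoint_self hM hA h (right_mem_line hM.ne) hDM) hEl rfl).trans h.symm
  have hEM : M ≠ E := hE.1.symm
  have hEB : E ∈ line M B := ((mem_openRay_iff (line_mem_lines hMB) (left_mem_line hMB)
    (right_mem_line hMB) hMB.symm).1 hE).1
  have hline : line M B = line M E :=
    eq_line (line_mem_lines hMB) hEM (left_mem_line hMB) hEB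
  have hEl' : E ∉ line C D := fun hn =>
    notMem_line_of_ne hl hn hM.mem_line hB hEM.symm hEB
  have hBE : B ∈ line M E := hline ▸ right_mem_line hMB
  suffices hs : E ∈ line M A by
    rwa [eq_line (line_mem_lines hMA) hEM (left_mem_line hMA) hs]
  by_cases hs : Crosses (line C D) A E
  · have hAE : A ≠ E := by
      obtain ⟨Q, -, hb⟩ := hs
      exact (btw_distinct _ _ _ hb).2.2
    obtain ⟨K, hK⟩ := midpoint A E hAE
    obtain ⟨Q, hQ, hQ'⟩ := hs.exists_mem_line
    obtain rfl := midpoint_eq_of_rhombus hM hK h f1 f2 hA hQ hQ'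
    rw [← eq_line (line_mem_lines hAE) hMA hK.mem_line (left_mem_line hAE)]
    exact right_mem_line hAE
  · obtain ⟨A', hA', hc, hMA', g1, g2⟩ := exists_opposite hM hA h
    have hc' : Crosses (line C D) A' E := by
      obtain ⟨s, hs'⟩ := exists_side hl
      have e1 := hs' A hA A' hA'
      have e2 := hs' A' hA' E hEl'
      have e3 := hs' A hA E hEl'
      tauto
    have hAE : A' ≠ E := by
      obtain ⟨Q, -, hb⟩ := hc'
      exact (btw_distinct _ _ _ hb).2.2
    obtain ⟨K, hK⟩ := midpoint A' E hAE
    obtain ⟨Q, hQ, hQ'⟩ := hc'.exists_mem_line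
    obtain rfl := midpoint_eq_of_rhombus hM hK (g1.trans g2.symm) (f1.trans g1.symm)
      (f2.trans g1.symm) hA' hQ hQ'
    have hA'l : A' ∈ line K A := btw_mem_right (line_mem_lines hMA) hMA'.1 (right_mem_line hMA)
      (left_mem_line hMA)
    exact btw_mem_right (line_mem_lines hMA) hK.1 hA'l (left_mem_line hMA)

/-- Every point of the line other than `M` lies on the ray from `M` through `A` or through its
opposite point, so it makes right angles at `M` with both halves of `CD`. -/
theorem len_eq_of_mem_line {A C D M X : P} (hM : IsMidpoint M C D) (hA : A ∉ line C D)
    (h : len A C = len A D) (hX : X ∈ line M A) : len X C = len X D := by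
  have key : ∀ B, B ∉ line C D → len B C = len B D → X ∈ openRay M B → len X C = len X D :=
    fun B hB hB' hXB => hypotenuse_eq
      (isRightAngle_midpoint hM hB hB' (left_mem_line hM.ne) hM.ne_left hXB)
      (isRightAngle_midpoint hM hB hB' (right_mem_line hM.ne) hM.symm.ne_left hXB) rfl hM.len_eq
  by_cases hXM : X = M
  · exact hXM ▸ hM.len_eq
  obtain ⟨B, hB, -, hMB, g1, g2⟩ := exists_opposite hM hA h
  have hMA : M ≠ A := fun e => hA (e ▸ hM.mem_line)
  have : line M A = line A B := eq_line (line_mem_lines hMA) hMB.ne (right_mem_line hMA)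
    (btw_mem_right (line_mem_lines hMA) hMB.1 (right_mem_line hMA) (left_mem_line hMA))
  rcases exists_mem_openRay_of_midpoint hMB (this ▸ hX) hXM with h' | h'
  · exact key A hA h h'
  · exact key B hB (g1.trans g2.symm) h'

/-- A line with two points equidistant from `C` and `D` bisects `CD`. -/
theorem midpoint_mem_of_len_eq {A B C D M : P} {l : Set P} (hl : l ∈ lines) (hAl : A ∈ l)
    (hBl : B ∈ l) (hM : IsMidpoint M C D) (hAB : A ≠ B) (hA : len A C = len A D)
    (hB : len B C = len B D) : M ∈ l := by
  by_cases hAl' : A ∈ line C D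
  · exact eq_midpoint hM hAl' hA ▸ hAl
  by_cases hBl' : B ∈ line C D
  · exact eq_midpoint hM hBl' hB ▸ hBl
  have hMA : M ≠ A := fun e => hAl' (e ▸ hM.mem_line)
  rw [eq_line hl hAB hAl hBl, ← eq_line (line_mem_lines hMA) hAB (right_mem_line hMA)
    (mem_line_of_len_eq hM hAl' hA hBl' hB)]
  exact left_mem_line hMA

theorem eq_of_sameSide {l : Set P} (hl : l ∈ lines) {A B C D : P} (hA : A ∈ l) (hB : B ∈ l)
    (hAB : A ≠ B) (hs : SameSide l C D) (h : len A C = len A D) (h' : len B C = len B D) :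
    C = D := by
  by_contra hCD
  obtain ⟨M, hM⟩ := midpoint C D hCD
  exact hs.2.2 M (midpoint_mem_of_len_eq hl hA hB hM hAB h h') hM.1

/-- A point is determined by its distances from three points that are not collinear. -/
theorem eq_of_len_eq_three {O A B X Y : P} (hOA : O ≠ A) (hB : B ∉ line O A)
    (h₁ : len O X = len O Y) (h₂ : len A X = len A Y) (h₃ : len B X = len B Y) : X = Y := by
  by_contra hXY
  -- The midpoint of `XY` would lie on all three side lines of the triangle, hence coincide with
  -- both `O` and `A`.
  obtain ⟨M, hM⟩ := midpoint X Y hXY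
  have hOB : O ≠ B := fun e => hB (e ▸ left_mem_line hOA)
  have hAB : A ≠ B := fun e => hB (e ▸ right_mem_line hOA)
  have m1 := midpoint_mem_of_len_eq (line_mem_lines hOA) (left_mem_line hOA)
    (right_mem_line hOA) hM hOA h₁ h₂
  have m2 := midpoint_mem_of_len_eq (line_mem_lines hOB) (left_mem_line hOB)
    (right_mem_line hOB) hM hOB h₁ h₃
  have m3 := midpoint_mem_of_len_eq (line_mem_lines hAB) (left_mem_line hAB)
    (right_mem_line hAB) hM hAB h₂ h₃
  have e1 := meet_unique (line_mem_lines hOB) (line_mem_lines hOA) (right_mem_line hOB) hB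
    m2 m1 (left_mem_line hOB) (left_mem_line hOA)
  have e2 := meet_unique (line_mem_lines hAB) (line_mem_lines hOA) (right_mem_line hAB) hB
    m3 m1 (left_mem_line hAB) (right_mem_line hOA)
  exact hOA (e1.symm.trans e2)

/-! ### Reflections and rigid motions -/

theorem crosses_of_len_eq {l : Set P} (hl : l ∈ lines) {A B X Y : P} (hA : A ∈ l) (hB : B ∈ l)
    (hAB : A ≠ B) (hX : X ∉ l) (hXY : X ≠ Y) (h : len A X = len A Y) (h' : len B X = len B Y) :
    Y ∉ l ∧ Crosses l X Y := by
  obtain ⟨M, hM⟩ := midpoint X Y hXY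
  have hMl := midpoint_mem_of_len_eq hl hA hB hM hAB h h'
  exact ⟨fun hY => hX (btw_mem_left hl hM.1 hMl hY), M, hMl, hM.1⟩

/-- The copy of the triangle `ABX` on the other side of `l` gives a `Y` equidistant from `X` at two
points of `l`; the midpoint of `XY` is then on `l`, which makes `l` the perpendicular bisector. -/
theorem exists_reflected_point {l : Set P} (hl : l ∈ lines) {X : P} (hX : X ∉ l) :
    ∃ Y, Y ≠ X ∧ ∀ D ∈ l, len D X = len D Y := by
  obtain ⟨A, hA, B, hB, hAB⟩ := two_points l hl
  obtain ⟨Z, hZ, hXZ⟩ := exists_crosses hl hX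
  have hXl : ¬ Coll A B X := by
    change X ∉ line A B
    rwa [← eq_line hl hAB hA hB]
  obtain ⟨Y, hZY, h1, h2⟩ := triangle_transport A B X A B l hl hXl hA hB (cong_iff.2 rfl) Z hZ
  rw [cong_iff] at h1 h2
  have hXY : Y ≠ X := by
    obtain ⟨Q, -, hb⟩ := crosses_of_crosses_of_sameSide hl hX hXZ hZY
    exact (btw_distinct _ _ _ hb).2.2.symm
  refine ⟨Y, hXY, ?_⟩
  obtain ⟨M, hM⟩ := midpoint X Y hXY.symm
  have hMl := midpoint_mem_of_len_eq hl hA hB hM hAB h1.symm h2.symm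
  have key : ∀ E ∈ l, E ≠ M → len E X = len E Y → ∀ D ∈ l, len D X = len D Y :=
    fun E hE hEM hEl D hD => by
      have hE' : E ∉ line X Y := fun h => hEM (eq_midpoint hM h hEl)
      exact len_eq_of_mem_line hM hE' hEl (eq_line hl hEM.symm hMl hE ▸ hD)
  by_cases hAM : A = M
  · exact key B hB (fun h => hAB (hAM.trans h.symm)) h2.symm
  · exact key A hA hAM h1.symm

theorem exists_foot {l : Set P} (hl : l ∈ lines) {X : P} (hX : X ∉ l) :
    ∃ F ∈ l, ∀ D ∈ l, D ≠ F → IsRightAngle D F X := by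
  obtain ⟨A, hA, B, hB, hAB⟩ := two_points l hl
  obtain ⟨Y, hYX, hY⟩ := exists_reflected_point hl hX
  obtain ⟨F, hF⟩ := midpoint X Y hYX.symm
  have hFl := midpoint_mem_of_len_eq hl hA hB hF hAB (hY A hA) (hY B hB)
  refine ⟨F, hFl, fun D hD hDF => isRightAngle_midpoint_self hF (fun h => hDF ?_) (hY D hD)
    (left_mem_line hF.ne) hF.ne_left⟩
  exact eq_midpoint hF h (hY D hD)

theorem exists_isMidpoint {A M : P} (h : A ≠ M) : ∃ B, IsMidpoint M A B := by
  obtain ⟨G, hG⟩ := btw_extend A M h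
  have hMG := (btw_distinct _ _ _ hG).2.1
  obtain ⟨B, hB, hBl⟩ := exists_openRay_len h.symm hMG
  have hl := line_mem_lines h
  have hM := right_mem_line h
  have hGl := btw_mem_right hl hG (left_mem_line h) hM
  rw [mem_openRay_iff hl hM hGl hMG.symm] at hB
  refine ⟨B, ?_, cong_iff.2 hBl.symm⟩
  rcases btw_or_btw hG hl (left_mem_line h) hGl hB.1 hB.2.1 with h' | h'
  · exact h'
  · exact absurd (btw_symm _ _ _ h') hB.2.2

/-! ### Extending isometries of lines to points off the line. -/

theorem LineIsometry.ne {k k' : Set P} {g : P → P} (hg : LineIsometry k k' g) {X Y : P}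
    (hX : X ∈ k) (hY : Y ∈ k) (h : X ≠ Y) : g X ≠ g Y :=
  ne_of_len_eq (hg.len_eq X hX Y hY).symm h

theorem LineIsometry.isMidpoint {k k' : Set P} {g : P → P} (hg : LineIsometry k k' g)
    {M B C : P} (hMk : M ∈ k) (hB : B ∈ k) (hC : C ∈ k) (hM : IsMidpoint M B C) :
    IsMidpoint (g M) (g B) (g C) :=
  ⟨(hg.btw B hB M hMk C hC).1 hM.1, cong_iff.2 (by
    rw [← hg.len_eq M hMk B hB, ← hg.len_eq M hMk C hC, hM.len_eq])⟩

/-- An isometry of lines extends to a point off the line. -/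
theorem LineIsometry.exists_len_eq {k k' : Set P} (hk : k ∈ lines) (hk' : k' ∈ lines)
    {g : P → P} (hg : LineIsometry k k' g) {C X : P} (hC : C ∉ k) (hX : X ∉ k') :
    ∃ C', SameSide k' X C' ∧ ∀ D ∈ k, len C D = len C' (g D) := by
  obtain ⟨F, hF, hr⟩ := exists_foot hk hC
  obtain ⟨E, hE, hEF⟩ := exists_ne_mem hk F
  -- `E` and `G` are symmetric about the foot `F`, so `EGC` is isosceles and its copy has a right
  -- angle at `g F`. Congruence of the altitudes then gives all other distances as hypotenuses.
  obtain ⟨G, hG⟩ := exists_isMidpoint hEF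
  have hGk := btw_mem_right hk hG.1 hE hF
  have hCE : len C E = len C G := by
    rw [len_comm C, len_comm C]
    exact hypotenuse_eq (hr E hE hEF) (hr G hGk hG.symm.ne_left) hG.len_eq rfl
  have hCl : ¬ Coll E G C := by
    change C ∉ line E G
    rwa [← eq_line hk hG.ne hE hGk]
  obtain ⟨C', hs, h1, h2⟩ := triangle_transport E G C (g E) (g G) k' hk' hCl (hg.mem E hE)
    (hg.mem G hGk) (cong_iff.2 (hg.len_eq E hE G hGk).symm) X hX
  rw [cong_iff, len_comm, len_comm E] at h1
  rw [cong_iff, len_comm, len_comm G] at h2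
  have hG' := hg.isMidpoint hF hE hGk hG
  have hC'k : C' ∉ k' := hs.2.1
  have hline : k' = line (g E) (g G) := eq_line hk' hG'.ne (hg.mem E hE) (hg.mem G hGk)
  have hr' : ∀ D ∈ k, D ≠ F → IsRightAngle (g D) (g F) C' := fun D hD hDF =>
    (isRightAngle_midpoint_self hG' (hline ▸ hC'k) (by rw [h1, h2, hCE])
      (hline ▸ hg.mem D hD) (hg.ne hD hF hDF)).symm
  have hleg : len F C = len (g F) C' := by
    refine (leg_eq (hr' E hE hEF).symm (hr E hE hEF).symm ?_ ?_ h1).symm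
    · intro hEl
      have hFC : F ≠ C := fun e => hC (e ▸ hF)
      exact hEF (meet_unique (line_mem_lines hFC) hk (right_mem_line hFC) hC hEl hE
        (left_mem_line hFC) hF)
    · exact (hg.len_eq F hF E hE).symm
  refine ⟨C', hs, fun D hD => ?_⟩
  rw [len_comm C, len_comm C']
  by_cases hDF : D = F
  · rw [hDF, hleg]
  · exact hypotenuse_eq (hr D hD hDF) (hr' D hD hDF) (hg.len_eq F hF D hD) hleg

/-- The five segment property. -/
theorem LineIsometry.len_eq_of_len_eq {k k' : Set P} (hk : k ∈ lines) (hk' : k' ∈ lines)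
    {g : P → P} (hg : LineIsometry k k' g) {A B C C' D : P} (hC : C ∉ k) (hC' : C' ∉ k')
    (hA : A ∈ k) (hB : B ∈ k) (hAB : A ≠ B) (h₁ : len C A = len C' (g A))
    (h₂ : len C B = len C' (g B)) (hD : D ∈ k) : len C D = len C' (g D) := by
  -- The extension is taken on the side of `C'`; two distances determine a point on a side, so it is
  -- `C'` itself.
  obtain ⟨C₂, hs, h⟩ := hg.exists_len_eq hk hk' hC hC'
  have : C' = C₂ := eq_of_sameSide hk' (hg.mem A hA) (hg.mem B hB) (hg.ne hA hB hAB) hs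
    (by rw [len_comm, ← h₁, h A hA, len_comm]) (by rw [len_comm, ← h₂, h B hB, len_comm])
  rw [this, h D hD]

/-- Provides a point that, with the midpoint, spans the perpendicular bisector of `AB`. The
isosceles triangle is built over a segment congruent to `AB` centered at a foot `F`, then
transported to `AB`. -/
theorem exists_isosceles {A B : P} (hAB : A ≠ B) :
    ∃ C, C ∉ line A B ∧ len C A = len C B := by
  have hl := line_mem_lines hAB
  obtain ⟨M, hM⟩ := midpoint A B hAB
  obtain ⟨X, hX⟩ := exists_notMem hl
  obtain ⟨F, hF, hr⟩ := exists_foot hl hX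
  obtain ⟨G, hG, hGF⟩ := exists_ne_mem hl F
  obtain ⟨E, hE, hEl⟩ := exists_openRay_len hM.ne_left.symm hGF.symm
  have hEk := ((mem_openRay_iff hl hF hG hGF).1 hE).1
  obtain ⟨E', hE'⟩ := exists_isMidpoint hE.1
  have hE'k := btw_mem_right hl hE'.1 hEk hF
  have hXE : len X E = len X E' := by
    rw [len_comm X, len_comm X]
    exact hypotenuse_eq (hr E hEk hE.1) (hr E' hE'k hE'.symm.ne_left) hE'.len_eq rfl
  have hEE : len A B = len E E' := len_add hM.1 hE'.1
    (by rw [len_comm A, ← hEl, len_comm]) (by rw [← hM.len_eq, ← hE'.len_eq, hEl])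
  have hXl : ¬ Coll E E' X := by
    change X ∉ line E E'
    rwa [← eq_line hl hE'.ne hEk hE'k]
  obtain ⟨C, hs, h1, h2⟩ := triangle_transport E E' X A B (line A B) hl hXl (left_mem_line hAB)
    (right_mem_line hAB) (cong_iff.2 hEE) X hX
  rw [cong_iff, len_comm, len_comm E] at h1
  rw [cong_iff, len_comm, len_comm E'] at h2
  exact ⟨C, hs.2.1, by rw [h1, h2, hXE]⟩

/-! ### Reflections preserve lengths. -/

/-- `σ` is the reflection in the line `l`. -/
structure IsReflection (l : Set P) (σ : P → P) : Prop where
  fix : ∀ X ∈ l, σ X = X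
  ne : ∀ X, X ∉ l → σ X ≠ X
  len_eq : ∀ X, ∀ D ∈ l, len D X = len D (σ X)

theorem exists_isReflection {l : Set P} (hl : l ∈ lines) : ∃ σ, IsReflection l σ := by
  have : ∀ X, ∃ Y, (X ∈ l → Y = X) ∧ (X ∉ l → Y ≠ X) ∧ ∀ D ∈ l, len D X = len D Y := fun X => by
    by_cases hX : X ∈ l
    · exact ⟨X, fun _ => rfl, fun h => absurd hX h, fun _ _ => rfl⟩
    · obtain ⟨Y, h1, h2⟩ := exists_reflected_point hl hX
      exact ⟨Y, fun h => absurd h hX, fun _ => h1, h2⟩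
  choose σ h1 h2 h3 using this
  exact ⟨σ, h1, h2, h3⟩

namespace IsReflection

variable {l : Set P} {σ : P → P}

theorem crosses (hσ : IsReflection l σ) (hl : l ∈ lines) {X : P} (hX : X ∉ l) :
    σ X ∉ l ∧ Crosses l X (σ X) := by
  obtain ⟨A, hA, B, hB, hAB⟩ := two_points l hl
  exact crosses_of_len_eq hl hA hB hAB hX (hσ.ne X hX).symm (hσ.len_eq X A hA)
    (hσ.len_eq X B hB)

theorem eq_of_len_eq (hσ : IsReflection l σ) (hl : l ∈ lines) {X Y : P} (hX : X ∉ l)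
    (hXY : X ≠ Y) (h : ∀ D ∈ l, len D X = len D Y) : σ X = Y := by
  obtain ⟨A, hA, B, hB, hAB⟩ := two_points l hl
  obtain ⟨h1, h2⟩ := hσ.crosses hl hX
  obtain ⟨h3, h4⟩ := crosses_of_len_eq hl hA hB hAB hX hXY (h A hA) (h B hB)
  refine eq_of_sameSide hl hA hB hAB (sameSide_of_crosses_of_crosses hl hX h1 h3 h2 h4) ?_ ?_
  · rw [← hσ.len_eq X A hA, h A hA]
  · rw [← hσ.len_eq X B hB, h B hB]

theorem involutive (hσ : IsReflection l σ) (hl : l ∈ lines) : Function.Involutive σ := fun X => by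
  by_cases hX : X ∈ l
  · rw [hσ.fix X hX, hσ.fix X hX]
  · exact hσ.eq_of_len_eq hl (hσ.crosses hl hX).1 (hσ.ne X hX)
      fun D hD => (hσ.len_eq X D hD).symm

/-- The line isometry with `D ↦ D` and `Z ↦ σ Z` must agree with `σ`: it takes each `Y` off `l`
across `l`, to a point with the same distances from all points of `l`. -/
theorem lineIsometry (hσ : IsReflection l σ) (hl : l ∈ lines) {D Z : P} (hD : D ∈ l)
    (hZ : Z ∉ l) : LineIsometry (line D Z) (line D (σ Z)) σ := by
  obtain ⟨hσZ, hc⟩ := hσ.crosses hl hZ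
  have hDZ : D ≠ Z := fun e => hZ (e ▸ hD)
  have hDZ' : D ≠ σ Z := fun e => hσZ (e ▸ hD)
  have hk := line_mem_lines hDZ
  have hk' := line_mem_lines hDZ'
  obtain ⟨g, hg, hgD, hgZ⟩ := exists_lineIsometry hk hk' (left_mem_line hDZ)
    (right_mem_line hDZ) (left_mem_line hDZ') (right_mem_line hDZ') hDZ (hσ.len_eq Z D hD)
  have key : ∀ Y ∈ line D Z, g Y = σ Y := fun Y hY => by
    by_cases hYD : Y = D
    · rw [hYD, hgD, hσ.fix D hD]
    have hYl : Y ∉ l := fun h => notMem_line_of_ne hl h hD hZ hYD hY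
    have hgYD : g Y ≠ D := hgD ▸ hg.ne hY (left_mem_line hDZ) hYD
    have hgYl : g Y ∉ l := fun h => notMem_line_of_ne hl h hD hσZ hgYD (hg.mem Y hY)
    have heq : ∀ E ∈ l, len E Y = len E (g Y) := fun E hE => by
      by_cases hED : E = D
      · have := hg.len_eq D (left_mem_line hDZ) Y hY
        rwa [hgD, ← hED] at this
      -- Five segment property with `E` as the point off both lines.
      · exact hg.len_eq_of_len_eq hk hk' (notMem_line_of_ne hl hE hD hZ hED)
          (notMem_line_of_ne hl hE hD hσZ hED) (left_mem_line hDZ) (right_mem_line hDZ) hDZ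
          (by rw [hgD]) (by rw [hgZ, hσ.len_eq Z E hE]) hY
    have hcross : Crosses l Y (g Y) := by
      have b := hg.btw Z (right_mem_line hDZ) D (left_mem_line hDZ) Y hY
      rw [hgZ, hgD, ← crosses_at hk hl (left_mem_line hDZ) hD (right_mem_line hDZ) hZ hY,
        ← crosses_at hk' hl (left_mem_line hDZ') hD (right_mem_line hDZ') hσZ (hg.mem Y hY)] at b
      obtain ⟨s, hs⟩ := exists_side hl
      have e1 := hs Z hZ Y hYl
      have e2 := hs (σ Z) hσZ (g Y) hgYl
      have e3 := hs Z hZ (σ Z) hσZ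
      have e4 := hs Y hYl (g Y) hgYl
      clear * - b e1 e2 e3 e4 hc
      tauto
    have hne : Y ≠ g Y := by
      obtain ⟨Q, -, hb⟩ := hcross
      exact (btw_distinct _ _ _ hb).2.2
    exact (hσ.eq_of_len_eq hl hYl hne heq).symm
  refine ⟨fun X hX => ?_, fun X hX Y hY => ?_, fun X hX Y hY Z hZ => ?_⟩
  · rw [← key X hX]
    exact hg.mem X hX
  · rw [← key X hX, ← key Y hY]
    exact hg.len_eq X hX Y hY
  · rw [← key X hX, ← key Y hY, ← key Z hZ]
    exact hg.btw X hX Y hY Z hZ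

/-- Reflections are isometries. -/
theorem len_map (hσ : IsReflection l σ) (hl : l ∈ lines) (X Y : P) :
    len X Y = len (σ X) (σ Y) := by
  by_cases hX : X ∈ l
  · rw [hσ.fix X hX, hσ.len_eq Y X hX]
  by_cases hY : Y ∈ l
  · rw [hσ.fix Y hY, len_comm X, len_comm (σ X), hσ.len_eq X Y hY]
  by_cases hc : Crosses l X Y
  · obtain ⟨D, hD, hb⟩ := hc
    have hDY := (btw_distinct _ _ _ hb).2.1
    exact (hσ.lineIsometry hl hD hY).len_eq X (btw_mem_left (line_mem_lines hDY) hb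
      (left_mem_line hDY) (right_mem_line hDY)) Y (right_mem_line hDY)
  obtain ⟨hZ, hXZ⟩ := hσ.crosses hl hX
  -- `X` and `Y` are on the same side, so `Z = σ X` is opposite to both, and the lines `XZ` and `YZ`
  -- meet `l`, at `D` and `E`.
  set Z := σ X with hZdef
  have hYZ : Crosses l Y Z := by
    obtain ⟨s, hs⟩ := exists_side hl
    have e1 := hs X hX Y hY
    have e2 := hs X hX Z hZ
    have e3 := hs Y hY Z hZ
    clear * - e1 e2 e3 hc hXZ
    tauto
  obtain ⟨D, hD, hbX⟩ := hXZ
  obtain ⟨E, hE, hbY⟩ := hYZ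
  have hDZ := (btw_distinct _ _ _ hbX).2.1
  have hEZ := (btw_distinct _ _ _ hbY).2.1
  have hXk : X ∈ line D Z :=
    btw_mem_left (line_mem_lines hDZ) hbX (left_mem_line hDZ) (right_mem_line hDZ)
  have hYk : Y ∈ line E Z :=
    btw_mem_left (line_mem_lines hEZ) hbY (left_mem_line hEZ) (right_mem_line hEZ)
  have iD := hσ.lineIsometry hl hD hZ
  have iE := hσ.lineIsometry hl hE hZ
  by_cases hXE : X ∈ line E Z
  · exact iE.len_eq X hXE Y hYk
  have hσZ := (hσ.crosses hl hZ).1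
  have hEZ' : E ≠ σ Z := fun e => hσZ (e ▸ hE)
  -- Five segment property on the line `EZ`, with `X` and `σ X` as the outer points: their distances
  -- to `E`, `Z` and the images of these match, hence also those to `Y` and `σ Y`.
  refine iE.len_eq_of_len_eq (line_mem_lines hEZ) (line_mem_lines hEZ') hXE (fun h => hXE ?_)
    (left_mem_line hEZ) (right_mem_line hEZ) hEZ ?_ (iD.len_eq X hXk Z (right_mem_line hDZ)) hYk
  · have := (hσ.lineIsometry hl hE hσZ).mem Z h
    rwa [hσ.involutive hl Z, hZdef, hσ.involutive hl X] at this
  · rw [hσ.fix E hE, len_comm X, len_comm Z, hσ.len_eq X E hE]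

end IsReflection

/-! ### Rigid motions from congruent triples. -/

theorem isRigidMotion_iff {φ : Equiv.Perm P} :
    IsRigidMotion φ ↔ ∀ A B, len A B = len (φ A) (φ B) := by
  simp [IsRigidMotion, cong_iff]

theorem IsRigidMotion.len_eq {φ : Equiv.Perm P} (h : IsRigidMotion φ) (A B : P) :
    len A B = len (φ A) (φ B) := isRigidMotion_iff.1 h A B

theorem IsRigidMotion.mul {φ ψ : Equiv.Perm P} (h : IsRigidMotion φ) (h' : IsRigidMotion ψ) :
    IsRigidMotion (φ * ψ) :=
  isRigidMotion_iff.2 fun A B => (h'.len_eq A B).trans (h.len_eq _ _)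

/-- There is a rigid motion that takes `A` to `B` and fixes all points equidistant from them. -/
theorem exists_isRigidMotion_swap (A B : P) : ∃ φ : Equiv.Perm P, IsRigidMotion φ ∧ φ A = B ∧
    ∀ X, len X A = len X B → φ X = X := by
  by_cases hAB : A = B
  · subst hAB
    exact ⟨1, isRigidMotion_iff.2 fun _ _ => rfl, rfl, fun _ _ => rfl⟩
  -- The motion is the reflection in `MC`, the perpendicular bisector of `AB`.
  obtain ⟨C, hC, hCl⟩ := exists_isosceles hAB
  obtain ⟨M, hM⟩ := midpoint A B hAB
  have hMC : M ≠ C := fun e => hC (e ▸ hM.mem_line)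
  have hl := line_mem_lines hMC
  have hmem : ∀ X, len X A = len X B → X ∈ line M C := fun X hX => by
    by_cases hXl : X ∈ line A B
    · rw [eq_midpoint hM hXl hX]
      exact left_mem_line hMC
    · exact mem_line_of_len_eq hM hC hCl hXl hX
  have hlen : ∀ D ∈ line M C, len D A = len D B := fun D hD => len_eq_of_mem_line hM hC hCl hD
  obtain ⟨σ, hσ⟩ := exists_isReflection hl
  have hA : A ∉ line M C := fun h => hAB (eq_of_len_eq_self (by
    rw [len_comm B A, ← hlen A h]) : B = A).symm
  exact ⟨(hσ.involutive hl).toPerm, isRigidMotion_iff.2 (hσ.len_map hl),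
    hσ.eq_of_len_eq hl hA hAB hlen, fun X hX => hσ.fix X (hmem X hX)⟩

/-- Congruent triangles are related by a rigid motion. -/
theorem exists_isRigidMotion {A B C A' B' C' : P} (h₁ : len A B = len A' B')
    (h₂ : len A C = len A' C') (h₃ : len B C = len B' C') :
    ∃ φ : Equiv.Perm P, IsRigidMotion φ ∧ φ A = A' ∧ φ B = B' ∧ φ C = C' := by
  obtain ⟨φ, hφ, hφA, -⟩ := exists_isRigidMotion_swap A A'
  obtain ⟨ψ, hψ, hψB, hψf⟩ := exists_isRigidMotion_swap (φ B) B'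
  -- `A'` is equidistant from `φ B` and `B'`, so the second motion leaves it in place; likewise the
  -- third fixes `A'` and `B'`.
  have hψA : ψ A' = A' := hψf _ (by rw [← hφA, ← hφ.len_eq, h₁, hφA])
  obtain ⟨χ, hχ, hχC, hχf⟩ := exists_isRigidMotion_swap (ψ (φ C)) C'
  refine ⟨χ * (ψ * φ), hχ.mul (hψ.mul hφ), ?_, ?_, hχC⟩
  · change χ (ψ (φ A)) = A'
    rw [hφA, hψA]
    exact hχf _ (by rw [← h₂, hφ.len_eq A C, hψ.len_eq (φ A), hφA, hψA])
  · change χ (ψ (φ B)) = B'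
    rw [hψB]
    exact hχf _ (by rw [← h₃, hφ.len_eq B C, hψ.len_eq (φ B), hψB])

/-! ### Coordinates -/

namespace Magnitudes

variable {R : OrderedLine P}

theorem len_eq (t : Magnitudes R) (A B : R.carrier) :
    len (A : P) B = len (t.1 A : P) (t.1 B) := cong_iff.1 (t.2.2 A B)

theorem ext_of_apply_eq {s t : Magnitudes R} {X : R.carrier} (h : s.1 X = t.1 X) : s = t :=
  Subtype.ext (Equiv.ext (OrderedLine.isometry_unique (fun A B => (s.2.1 A B).1) (len_eq s)
    (fun A B => (t.2.1 A B).1) (len_eq t) h))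

theorem exists_apply_eq (X Y : R.carrier) : ∃ t : Magnitudes R, t.1 X = Y := by
  obtain ⟨g, h1, h2, h3⟩ := OrderedLine.exists_isometry X Y
  exact ⟨⟨g, h2, fun A B => cong_iff.2 (h3 A B)⟩, h1⟩

/-- If a translation advanced one point and moved another back, it would take a segment to one
nested strictly inside or around it, which is not congruent to it. -/
theorem one_lt_of_lt_apply {t : Magnitudes R} {X : R.carrier} (h : R.lt X (t.1 X))
    (Y : R.carrier) : R.lt Y (t.1 Y) := by
  rcases R.total Y (t.1 Y) with h' | h' | h'
  · exact h'
  · have : (1 : Magnitudes R) = t := ext_of_apply_eq h'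
    subst this
    exact absurd h (R.irrefl _)
  · exfalso
    rcases R.total X Y with h2 | rfl | h2
    · exact OrderedLine.len_ne_of_nested h ((t.2.1 _ _).1 h2) h' (len_eq t X Y).symm
    · exact R.irrefl _ (R.trans _ _ _ h h')
    · exact OrderedLine.len_ne_of_nested h' h2 h (len_eq t Y X)

theorem lt_of_apply_lt {s t : Magnitudes R} {X : R.carrier} (h : R.lt (s.1 X) (t.1 X)) :
    Lt s t := fun Y => by
  have h' : R.lt (s.1 X) ((t * s⁻¹).1 (s.1 X)) := by simpa using h
  simpa using one_lt_of_lt_apply h' (s.1 Y)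

/-- For `X` before `Y`, the segments from `X` to `t X` and from `Y` to `t Y` are what remains of the
segment from `X` to `t Y` after removing the congruent segments from `t X` to `t Y` and from `X` to
`Y`. -/
theorem len_apply_eq {t : Magnitudes R} (h : Lt 1 t) (X Y : R.carrier) :
    len (X : P) (t.1 X) = len (Y : P) (t.1 Y) := by
  have key : ∀ X Y : R.carrier, R.lt X Y → len (X : P) (t.1 X) = len (Y : P) (t.1 Y) :=
    fun X Y hXY => by
      have := OrderedLine.len_sub (L := R) (L' := R.rev) (A := X) (B := Y) (C := t.1 Y)
        (A' := t.1 Y) (B' := t.1 X) (C' := X) hXY (h Y) ((t.2.1 _ _).1 hXY)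
        (R.trans _ _ _ hXY (h Y)) (len_comm _ _) (by rw [len_eq t X Y, len_comm])
      rw [this.2, len_comm]
  rcases R.total X Y with h' | rfl | h'
  · exact key X Y h'
  · rfl
  · exact (key Y X h').symm

end Magnitudes

/-! ### Coordinatizations of lines. -/

/-- Translations correspond to points of `R` by evaluation at a base point `A`; an isometry from `R`
to `l` with `A ↦ O` then carries the coordinates over. -/
theorem exists_isCoordinatization (R l : OrderedLine P) {O : P} (hO : O ∈ l.carrier) :
    ∃ c, IsCoordinatization R l O c := by
  obtain ⟨A, hA, -⟩ := two_points R.carrier R.isLine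
  obtain ⟨h, hh, hlt, hlen⟩ := OrderedLine.exists_isometry (⟨A, hA⟩ : R.carrier)
    (⟨O, hO⟩ : l.carrier)
  have hb : Function.Bijective fun t : Magnitudes R => h (t.1 ⟨A, hA⟩) :=
    ⟨fun s t hst => Magnitudes.ext_of_apply_eq (h.injective hst), fun Y => by
      obtain ⟨t, ht⟩ := Magnitudes.exists_apply_eq ⟨A, hA⟩ (h.symm Y)
      exact ⟨t, by simp [ht]⟩⟩
  have hlt' : ∀ s t : Magnitudes R, Magnitudes.Lt s t ↔
      l.lt (h (s.1 ⟨A, hA⟩)) (h (t.1 ⟨A, hA⟩)) := fun s t => by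
    rw [← hlt]
    exact ⟨fun hst => hst _, Magnitudes.lt_of_apply_lt⟩
  refine ⟨Equiv.ofBijective _ hb, congrArg Subtype.val hh, hlt', fun s t hst => ?_⟩
  have h1 : Magnitudes.Lt 1 (t * s⁻¹) := fun X => by simpa using hst (s.1⁻¹ X)
  refine ⟨h1, fun X => cong_iff.2 ?_⟩
  rw [Magnitudes.len_apply_eq h1 X (s.1 ⟨A, hA⟩)]
  simpa using (hlen (s.1 ⟨A, hA⟩) (t.1 ⟨A, hA⟩)).symm

theorem Magnitudes.lt_trichotomy {R : OrderedLine P} (s t : Magnitudes R) :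
    Lt s t ∨ s = t ∨ Lt t s := by
  obtain ⟨A, hA, -⟩ := two_points R.carrier R.isLine
  rcases R.total (s.1 ⟨A, hA⟩) (t.1 ⟨A, hA⟩) with h | h | h
  · exact Or.inl (lt_of_apply_lt h)
  · exact Or.inr (Or.inl (ext_of_apply_eq h))
  · exact Or.inr (Or.inr (lt_of_apply_lt h))

theorem IsCoordinatization.len_eq {R l l' : OrderedLine P} {O O' : P}
    {c : Magnitudes R ≃ l.carrier} {c' : Magnitudes R ≃ l'.carrier}
    (hc : IsCoordinatization R l O c) (hc' : IsCoordinatization R l' O' c')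
    (s t : Magnitudes R) : len (c s : P) (c t) = len (c' s : P) (c' t) := by
  obtain ⟨A, hA, -⟩ := two_points R.carrier R.isLine
  have key : ∀ s t, Magnitudes.Lt s t → len (c s : P) (c t) = len (c' s : P) (c' t) :=
    fun s t h => (cong_iff.1 ((hc.2.2 s t h).2 ⟨A, hA⟩)).trans
      (cong_iff.1 ((hc'.2.2 s t h).2 ⟨A, hA⟩)).symm
  rcases Magnitudes.lt_trichotomy s t with h | rfl | h
  · exact key s t h
  · exact len_self _ _
  · rw [len_comm, key t s h, len_comm]

/-- Makes coordinates well defined: the coordinatizations hidden in separate instances of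
`HasCoordinate` for the same line and origin coincide. -/
theorem IsCoordinatization.unique {R l : OrderedLine P} {O : P}
    {c c' : Magnitudes R ≃ l.carrier} (hc : IsCoordinatization R l O c)
    (hc' : IsCoordinatization R l O c') : c = c' := by
  have h1 : c 1 = c' 1 := Subtype.ext (hc.1.trans hc'.1.symm)
  ext t
  have hl := hc.len_eq hc' 1 t
  congr 1
  rcases Magnitudes.lt_trichotomy 1 t with h | rfl | h
  · refine OrderedLine.eq_of_len_eq ((hc.2.1 _ _).1 h) (h1 ▸ (hc'.2.1 _ _).1 h) ?_
    rw [hl, h1]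
  · exact h1
  · refine OrderedLine.eq_of_len_eq (L := l.rev) ((hc.2.1 _ _).1 h)
      (h1 ▸ (hc'.2.1 _ _).1 h) ?_
    rw [hl, h1]

theorem exists_hasCoordinate (R l : OrderedLine P) {O X : P} (hO : O ∈ l.carrier)
    (hX : X ∈ l.carrier) : ∃ t, HasCoordinate R l O X t := by
  obtain ⟨c, hc⟩ := exists_isCoordinatization R l hO
  exact ⟨c.symm ⟨X, hX⟩, c, hc, by simp⟩

theorem HasCoordinate.mem {R l : OrderedLine P} {O X : P} {t : Magnitudes R}
    (h : HasCoordinate R l O X t) : X ∈ l.carrier := by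
  obtain ⟨c, -, rfl⟩ := h
  exact (c t).2

theorem hasCoordinate_one_iff {R l : OrderedLine P} {O X : P} (hO : O ∈ l.carrier) :
    HasCoordinate R l O X 1 ↔ X = O := by
  constructor
  · rintro ⟨c, hc, rfl⟩
    exact hc.1
  · rintro rfl
    obtain ⟨c, hc⟩ := exists_isCoordinatization R l hO
    exact ⟨c, hc, hc.1⟩

theorem HasCoordinate.len_eq {R l l' : OrderedLine P} {O O' X Y X' Y' : P} {s t : Magnitudes R}
    (hX : HasCoordinate R l O X s) (hY : HasCoordinate R l O Y t)
    (hX' : HasCoordinate R l' O' X' s) (hY' : HasCoordinate R l' O' Y' t) :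
    len X Y = len X' Y' := by
  obtain ⟨c, hc, rfl⟩ := hX
  obtain ⟨d, hd, rfl⟩ := hY
  obtain ⟨c', hc', rfl⟩ := hX'
  obtain ⟨d', hd', rfl⟩ := hY'
  rw [hd.unique hc, hd'.unique hc']
  exact hc.len_eq hc' s t

/-- A map that preserves the coordinates on an axis is isometric on it. -/
theorem isometric_on_axis {R l l' : OrderedLine P} {O O' : P} {Q : Set P} {f : Q → P}
    (hO : O ∈ l.carrier) (hO' : O' ∈ l'.carrier)
    (hf : ∀ X : Q, ∀ t, HasCoordinate R l O X t → HasCoordinate R l' O' (f X) t) :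
    (∀ X : Q, (X : P) ∈ l.carrier → f X ∈ l'.carrier) ∧
    (∀ X : Q, (X : P) = O → f X = O') ∧
    ∀ X Y : Q, (X : P) ∈ l.carrier → (Y : P) ∈ l.carrier → len (X : P) Y = len (f X) (f Y) := by
  refine ⟨fun X hX => ?_, fun X hX => ?_, fun X Y hX hY => ?_⟩
  · obtain ⟨t, ht⟩ := exists_hasCoordinate R l hO hX
    exact (hf X t ht).mem
  · exact (hasCoordinate_one_iff hO').1 (hf X 1 ((hasCoordinate_one_iff hO).2 hX))
  · obtain ⟨s, hs⟩ := exists_hasCoordinate R l hO hX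
    obtain ⟨t, ht⟩ := exists_hasCoordinate R l hO hY
    exact hs.len_eq ht (hf X s hs) (hf Y t ht)

/-! ### Extension of maps between systems of axes. -/

/-- The sides of a right angle are not collinear. -/
theorem _root_.PlaneData.IsRightAngle.notMem_line {A M B : P} (h : IsRightAngle A M B) :
    B ∉ line M A := by
  intro hB
  have hl := line_mem_lines h.1.symm
  have hM := left_mem_line h.1.symm
  have hA := right_mem_line h.1.symm
  have key : ∀ X ∈ line M A, X ≠ M → ∀ Y ∈ line M A, Y ≠ M → ¬ RightAlong X M Y := by
    rintro X hX hXM Y hY hYM ⟨A₀, hA₀, B₀, hB₀, C₀, hn, hm, -⟩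
    rw [mem_openRay_iff hl hM hX hXM] at hA₀
    rw [mem_openRay_iff hl hM hY hYM] at hB₀
    exact hn ⟨_, hl, hA₀.1, hB₀.1, btw_mem_right hl hm.1 hB₀.1 hM⟩
  rcases h.2.2 with h' | h'
  · exact key A hA h.1 B hB h.2.1 h'
  · exact key B hB h.2.1 A hA h.1 h'

/-- A map between two systems of axes that preserves coordinates extends to a unique rigid
motion. -/
theorem existsUnique_isRigidMotion (R : OrderedLine P) (S S' : SystemOfAxes P)
    (f : S.points → S'.points) (hf : PreservesAxisCoordinates R S S' f) :
    ∃! φ : Equiv.Perm P, IsRigidMotion φ ∧ ∀ X : S.points, φ (X : P) = (f X : P) := by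
  obtain ⟨-, -, hOl, hOm, hperp⟩ := S.perp
  obtain ⟨-, -, hOl', hOm', hperp'⟩ := S'.perp
  obtain ⟨l1, l2, l3⟩ := isometric_on_axis (f := fun X => (f X : P)) hOl hOl' hf.1
  obtain ⟨m1, -, m3⟩ := isometric_on_axis (f := fun X => (f X : P)) hOm hOm' hf.2
  obtain ⟨A, hA, hAO⟩ := exists_ne_mem S.l.isLine S.O
  obtain ⟨B, hB, hBO⟩ := exists_ne_mem S.m.isLine S.O
  lift A to S.points using Or.inl hA
  lift B to S.points using Or.inr hB
  obtain ⟨O, hO⟩ : ∃ O : S.points, (O : P) = S.O := ⟨⟨S.O, Or.inl hOl⟩, rfl⟩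
  rw [← hO] at hOl hOm hperp hAO hBO
  have hO' := l2 O hO
  rw [← hO'] at hperp'
  have ne : ∀ X : S.points, (X : P) ≠ O → (f X : P) ≠ f O := fun X hX => by
    rcases X.2 with h | h
    · exact ne_of_len_eq (l3 X O h hOl).symm hX
    · exact ne_of_len_eq (m3 X O h hOm).symm hX
  -- Points on different axes are the ends of a hypotenuse, unless one of them is the origin and
  -- both lie on one axis.
  have hlm : ∀ X Y : S.points, (X : P) ∈ S.l.carrier → (Y : P) ∈ S.m.carrier →
      len (X : P) Y = len (f X : P) (f Y) := fun X Y hX hY => by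
    by_cases hXO : (X : P) = O
    · obtain rfl := Subtype.ext hXO
      exact m3 X Y hOm hY
    by_cases hYO : (Y : P) = O
    · obtain rfl := Subtype.ext hYO
      exact l3 X Y hX hOl
    exact hypotenuse_eq (hperp X hX Y hY hXO hYO)
      (hperp' _ (l1 X hX) _ (m1 Y hY) (ne X hXO) (ne Y hYO)) (l3 O X hOl hX) (m3 O Y hOm hY)
  have hlen : ∀ X Y : S.points, len (X : P) Y = len (f X : P) (f Y) := fun X Y => by
    rcases X.2 with hX | hX <;> rcases Y.2 with hY | hY
    · exact l3 X Y hX hY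
    · exact hlm X Y hX hY
    · rw [len_comm, hlm Y X hY hX, len_comm]
    · exact m3 X Y hX hY
  have hB' : (f B : P) ∉ line (f O : P) (f A) :=
    (hperp' _ (l1 A hA) _ (m1 B hB) (ne A hAO) (ne B hBO)).notMem_line
  have heq : ∀ X Y : P, len (f O : P) X = len (f O : P) Y → len (f A : P) X = len (f A : P) Y →
      len (f B : P) X = len (f B : P) Y → X = Y := fun X Y =>
    eq_of_len_eq_three (ne A hAO).symm hB'
  obtain ⟨φ, hφ, hφO, hφA, hφB⟩ := exists_isRigidMotion (hlen O A) (hlen O B) (hlen A B)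
  have hdist : ∀ ψ : Equiv.Perm P, IsRigidMotion ψ → ∀ Z : S.points, ψ Z = f Z →
      ∀ X : P, len (f Z : P) (ψ X) = len (Z : P) X := fun ψ hψ Z hZ X => by
    rw [hψ.len_eq Z X, hZ]
  -- Agreement with `f` and uniqueness are both checked by comparing distances from the images of
  -- `O`, `A` and `B`.
  refine ⟨φ, ⟨hφ, fun X => heq _ _ ?_ ?_ ?_⟩, fun ψ ⟨hψ, hψf⟩ => Equiv.ext fun X =>
    heq _ _ ?_ ?_ ?_⟩
  · rw [hdist φ hφ O hφO, hlen]
  · rw [hdist φ hφ A hφA, hlen]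
  · rw [hdist φ hφ B hφB, hlen]
  · rw [hdist φ hφ O hφO, hdist ψ hψ O (hψf O)]
  · rw [hdist φ hφ A hφA, hdist ψ hψ A (hψf A)]
  · rw [hdist φ hφ B hφB, hdist ψ hψ B (hψf B)]

end AbsolutePlane

theorem theorem5 {P : Type*} [AbsolutePlane P] (R : AbsolutePlane.OrderedLine P)
    (S S' : AbsolutePlane.SystemOfAxes P) (f : S.points → S'.points)
    (hf : AbsolutePlane.PreservesAxisCoordinates R S S' f) :
    ∃! φ : Equiv.Perm P, AbsolutePlane.IsRigidMotion φ ∧ ∀ X : S.points, φ (X : P) = (f X : P) :=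
  AbsolutePlane.existsUnique_isRigidMotion R S S' f hf
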